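/- Consider the following pairs $(k,\ell)$, where $k$ is a totally real number field and $\ell$ a totally complex quadratic extension of $k$: $$\mathcal C_{20}=(\mathbb Q(\sqrt7),\mathbb Q(\sqrt7,\zeta_4)),\quad \mathcal C_{26}=(\mathbb Q(\sqrt{15}),\mathbb Q(\sqrt{15},\zeta_4)),\quad \mathcal C_{35}=(\mathbb Q(\zeta_{20}+\zeta_{20}^{-1}),\mathbb Q(\zeta_{20})).$$ In each case every finite place of $k$ is unramified in $\ell$. Let $p=2$ for $\mathcal C_{20}$ and $\mathcal C_{26}$, and $p=5$ for $\mathcal C_{35}$; let $\mathfrak v$ be the unique place of $k$ over $p$ (it splits in $\ell$), and let $v_o$ be a real place of $k$. Let $\mathcal D$ be a cubic division algebra with center $\ell$ whose local invariants at the two places of $\ell$ over $\mathfrak v$ are nonzero and negatives of each other, and whose local invariants at all other places are zero. Let $\sigma$ be an involution of $\mathcal D$ of the second kind, with fixed field $k$ in $\ell$, and let $G$ be the $k$-group with $G(k)=\{z\in\mathcal D^\times : z\sigma(z)=1,\ \mathrm{Nrd}(z)=1\}$; assume that $\sigma$ is chosen so that $G(k_{v_o})\cong \mathrm{SU}(2,1)$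 and $G(k_v)\cong\mathrm{SU}(3)$ is compact at every other real place $v$. Let $(P_v)$, $v$ running over the finite places of $k$, be a coherent collection of maximal parahoric subgroups $P_v\subset G(k_v)$ (coherent: $\prod_v P_v$ is open in the group of finite adelic points of $G$) such that $P_v$ is hyperspecial for all $v\neq\mathfrak v$, and let $\Lambda=G(k)\cap\prod_v P_v$. The group $G(k_{\mathfrak v})$ is the compact group $\mathrm{SL}_1(\mathfrak D)$, where $\mathfrak D$ is a cubic division algebra with center $k_{\mathfrak v}$; let $G(k_{\mathfrak v})^+$ be its first congruence subgroup, consisting of the elements of $\mathrm{SL}_1(\mathfrak D)$ congruent to $1$ modulo the maximal ideal of the valuation ring of $\mathfrak D$. In the case of $\mathcal C_{20}$ let $v'$ and $v''$ be the two places of $k$ over $3$, let $P'\subset G(k_{v'})$ and $P''\subset G(k_{v''})$ be non-hyperspecial maximal parahoric subgroups, and put $$\Lambda^+=\Lambda\cap G(k_{\mathfrak v})^+,\qquad \Lambda'=G(k)\cap P'\cap\prod_{v\ne v'}P_v,\qquad \Lambda''=G(k)\cap P''\cap\prod_{v\ne v''}P_v .$$ Then: (1) If $(k,\ell)=\mathcal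 C_{20}$, every nontrivial element of finite order of $G(k)$ has order $7$, and the groups $\Lambda^+$, $\Lambda'$ and $\Lambda''$ are torsion-free. (2) If $(k,\ell)$ is $\mathcal C_{26}$ or $\mathcal C_{35}$, then $G(k)$ is torsion-free. -/

import Mathlib

open scoped TensorProduct NumberField
open IsDedekindDomain Module

universe u v w

/-! ### The pairs of number fields -/

section Pairs

variable (k : Type u) (ℓ : Type v) [Field k] [NumberField k] [Field ℓ] [NumberField ℓ] [Algebra k ℓ]

/-- `(k, ℓ) = (ℚ(√7), ℚ(√7, ζ₄))`. -/
def IsC20 : Prop :=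
  ∃ (s : k) (i : ℓ), s ^ 2 = 7 ∧ IsPrimitiveRoot i 4 ∧
    IntermediateField.adjoin ℚ {s} = ⊤ ∧ IntermediateField.adjoin k {i} = ⊤

/-- `(k, ℓ) = (ℚ(√15), ℚ(√15, ζ₄))`. -/
def IsC26 : Prop :=
  ∃ (s : k) (i : ℓ), s ^ 2 = 15 ∧ IsPrimitiveRoot i 4 ∧
    IntermediateField.adjoin ℚ {s} = ⊤ ∧ IntermediateField.adjoin k {i} = ⊤

/-- `(k, ℓ) = (ℚ(ζ₂₀ + ζ₂₀⁻¹), ℚ(ζ₂₀))`. -/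
def IsC35 : Prop :=
  ∃ ζ : ℓ, IsPrimitiveRoot ζ 20 ∧ IntermediateField.adjoin ℚ {ζ} = ⊤ ∧
    Set.range (algebraMap k ℓ) = (IntermediateField.adjoin ℚ {ζ + ζ⁻¹} : IntermediateField ℚ ℓ)

end Pairs

/-! ### Involutions and special unitary groups of algebras with involution -/

/-- An `F`-linear involution (anti-automorphism of order dividing two) of an `F`-algebra. -/
structure AlgInvolution (F : Type u) (A : Type v) [Field F] [Ring A] [Algebra F A] where
  toLin : A →ₗ[F] A
  map_mul_rev : ∀ x y : A, toLin (x * y) = toLin y * toLin x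
  apply_apply : ∀ x : A, toLin (toLin x) = x

namespace AlgInvolution

variable {F : Type u} {A : Type v} [Field F] [Ring A] [Algebra F A] (σ : AlgInvolution F A)

theorem map_one : σ.toLin 1 = 1 := by
  have h := σ.map_mul_rev (σ.toLin 1) 1
  rw [mul_one, σ.apply_apply, mul_one] at h
  exact h.symm

/-- The involution `id ⊗ σ` of `E ⊗ A`, for a field extension `E` of `F`. -/
noncomputable def baseChange (E : Type w) [Field E] [Algebra F E] :
    AlgInvolution E (E ⊗[F] A) where
  toLin := σ.toLin.baseChange E
  map_mul_rev x y := by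
    induction x using TensorProduct.induction_on with
    | zero => simp
    | add x₁ x₂ h₁ h₂ => rw [add_mul, map_add, h₁, h₂, map_add, mul_add]
    | tmul a x =>
      induction y using TensorProduct.induction_on with
      | zero => simp
      | add y₁ y₂ h₁ h₂ => rw [mul_add, map_add, h₁, h₂, map_add, add_mul]
      | tmul b y => simp [σ.map_mul_rev, mul_comm a b]
  apply_apply x := by
    induction x using TensorProduct.induction_on with
    | zero => simp
    | add x₁ x₂ h₁ h₂ => rw [map_add, map_add, h₁, h₂]
    | tmul a x => simp [σ.apply_apply]

/-- The unitary group `{g | g σ(g) = 1}`. -/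
def unitaryGroup : Subgroup Aˣ where
  carrier := {g | (g : A) * σ.toLin g = 1}
  one_mem' := by simp [σ.map_one]
  mul_mem' := by
    intro a b ha hb
    simp only [Set.mem_ofPred_eq] at ha hb ⊢
    rw [Units.val_mul, σ.map_mul_rev, mul_assoc, ← mul_assoc (b : A), hb, one_mul, ha]
  inv_mem' := by
    intro a ha
    simp only [Set.mem_ofPred_eq] at ha ⊢
    have h : σ.toLin (a : A) = ((a⁻¹ : Aˣ) : A) := (Units.inv_eq_of_mul_eq_one_right ha).symm
    rw [← h, σ.apply_apply, h, Units.inv_mul]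

end AlgInvolution

/-- The units of reduced norm one of an `F`-algebra `A` which over an algebraic closure `Ω` of `F`
becomes a product of copies of `M₃(Ω)`. The components of the reduced norm over `Ω` are the
determinants of the images under the `F`-algebra homomorphisms `A → M₃(Ω)`. -/
noncomputable def reducedNormOne (F : Type u) (A : Type v) [Field F] [Ring A] [Algebra F A] :
    Subgroup Aˣ :=
  ⨅ φ : A →ₐ[F] Matrix (Fin 3) (Fin 3) (AlgebraicClosure F),
    (Units.map (Matrix.detMonoidHom.comp (φ : A →* Matrix (Fin 3) (Fin 3) (AlgebraicClosure F)))).ker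

/-- The group `{g ∈ Aˣ | g σ(g) = 1, Nrd(g) = 1}`. -/
noncomputable def specialUnitary {F : Type u} {A : Type v} [Field F] [Ring A] [Algebra F A]
    (σ : AlgInvolution F A) : Subgroup Aˣ :=
  σ.unitaryGroup ⊓ reducedNormOne F A

/-! ### Orders -/

section Orders

variable {O : Type u} {A : Type w} [CommRing O] [Ring A] [Algebra O A]

/-- An `O`-order in the `K`-algebra `A`: a subring that is a full `O`-lattice. -/
def IsLatticeOrder (K : Type v) [Field K] [Algebra K A] (R : Subalgebra O A) : Prop :=
  (Subalgebra.toSubmodule R).FG ∧ Submodule.span K (R : Set A) = ⊤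

/-- A maximal `O`-order in `A`. -/
def IsMaximalOrder (K : Type v) [Field K] [Algebra K A] (R : Subalgebra O A) : Prop :=
  Maximal (IsLatticeOrder K) R

/-- Stability under an involution. -/
def IsStable {K : Type v} [Field K] [Algebra K A] (σ : AlgInvolution K A)
    (R : Subalgebra O A) : Prop :=
  ∀ x ∈ R, σ.toLin x ∈ R

/-- The unit group of `R`, as a subgroup of the units of `A`. -/
def unitsOf (R : Subalgebra O A) : Subgroup Aˣ :=
  (Units.map (R.val : R →* A)).range

/-- The first congruence subgroup `1 + rad R` of `Rˣ`, as a subgroup of the units of `A`. -/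
noncomputable def congruenceUnits (R : Subalgebra O A) : Subgroup Aˣ :=
  (Units.map (Ideal.Quotient.mk (Ring.jacobson R) : R →* R ⧸ Ring.jacobson R)).ker.map
    (Units.map (R.val : R →* A))

end Orders

/-- A group without nontrivial elements of finite order. -/
def IsTorsionFreeSubgroup {M : Type u} [Group M] (H : Subgroup M) : Prop :=
  ∀ g ∈ H, IsOfFinOrder g → g = 1

/-! ### The global and local groups -/

section Groups

variable {k : Type u} {ℓ : Type v} {D : Type w} [Field k] [NumberField k] [Field ℓ]
  [NumberField ℓ] [Algebra k ℓ] [DivisionRing D] [Algebra k D] [Algebra ℓ D]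

/-- `D` is split at the place `w` of `ℓ`, that is, its local invariant there is zero. -/
def IsSplitAt (D : Type w) [DivisionRing D] [Algebra ℓ D] (w : HeightOneSpectrum (𝓞 ℓ)) : Prop :=
  Nonempty (w.adicCompletion ℓ ⊗[ℓ] D ≃ₐ[w.adicCompletion ℓ]
    Matrix (Fin 3) (Fin 3) (w.adicCompletion ℓ))

/-- The extension of `(D, σ)` along `τ : ℓ → ℂ` is the matrix algebra with the adjoint involution
of the hermitian form with Gram matrix `J`, where `J = J⁻¹`. -/
def IsAdjointAt (σ : AlgInvolution k D) (τ : ℓ →+* ℂ) (J : Matrix (Fin 3) (Fin 3) ℂ) : Prop :=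
  ∃ ψ : D →+* Matrix (Fin 3) (Fin 3) ℂ,
    (∀ a : ℓ, ψ (algebraMap ℓ D a) = Matrix.scalar (Fin 3) (τ a)) ∧
    ∀ x : D, ψ (σ.toLin x) = J * (ψ x).conjTranspose * J

/-- The arithmetic data defining the group `G`: `D` is a cubic division algebra with center `ℓ`,
ramified exactly at the places of `ℓ` over `𝔳`; `σ` is an involution of the second kind which is
of signature `(2,1)` at the real place `v₀` of `k` and definite at all the other real places. (Since
`D` has an involution of the second kind, its local invariants at two conjugate places are
automatically negatives of each other.) -/
structure IsGroupDatum (ℓ : Type v) [Field ℓ] [NumberField ℓ] [Algebra k ℓ] [Algebra ℓ D]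
    (σ : AlgInvolution k D) (v₀ : k →+* ℝ) (𝔳 : HeightOneSpectrum (𝓞 k)) : Prop where
  central : Algebra.IsCentral ℓ D
  finrank_eq : finrank ℓ D = 9
  second_kind : ∃ a : ℓ, σ.toLin (algebraMap ℓ D a) ≠ algebraMap ℓ D a
  split_iff : ∀ w : HeightOneSpectrum (𝓞 ℓ), IsSplitAt D w ↔ ¬ w.asIdeal.LiesOver 𝔳.asIdeal
  indefinite : ∀ τ : ℓ →+* ℂ, τ.comp (algebraMap k ℓ) = Complex.ofRealHom.comp v₀ →
    IsAdjointAt σ τ (Matrix.diagonal ![1, 1, -1])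
  definite : ∀ τ : ℓ →+* ℂ, τ.comp (algebraMap k ℓ) ≠ Complex.ofRealHom.comp v₀ →
    IsAdjointAt σ τ 1

/-- `k_v ⊗ D`. -/
abbrev LocalAlg (D : Type w) [DivisionRing D] [Algebra k D] (v : HeightOneSpectrum (𝓞 k)) :
    Type (max u w) :=
  v.adicCompletion k ⊗[k] D

/-- The involution `id ⊗ σ` of `k_v ⊗ D`. -/
noncomputable abbrev localInv (σ : AlgInvolution k D) (v : HeightOneSpectrum (𝓞 k)) :
    AlgInvolution (v.adicCompletion k) (LocalAlg D v) :=
  σ.baseChange (v.adicCompletion k)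

/-- The group `G(k_v)`. -/
noncomputable def localGroup (σ : AlgInvolution k D) (v : HeightOneSpectrum (𝓞 k)) :
    Subgroup (LocalAlg D v)ˣ :=
  specialUnitary (localInv σ v)

/-- The natural map `Dˣ → (k_v ⊗ D)ˣ`, through which `G(k)` is embedded in `G(k_v)`. -/
noncomputable def toLocal (D : Type w) [DivisionRing D] [Algebra k D]
    (v : HeightOneSpectrum (𝓞 k)) : Dˣ →* (LocalAlg D v)ˣ :=
  Units.map ((Algebra.TensorProduct.includeRight : D →ₐ[k] LocalAlg D v) : D →* LocalAlg D v)

/-- Maximality among the `σ`-stable `o_v`-orders of `k_v ⊗ D`. -/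
def IsMaximalStableOrder (σ : AlgInvolution k D) (v : HeightOneSpectrum (𝓞 k))
    (R : Subalgebra (v.adicCompletionIntegers k) (LocalAlg D v)) : Prop :=
  Maximal (fun S => IsLatticeOrder (v.adicCompletion k) S ∧ IsStable (localInv σ v) S) R

/-- `P` is a maximal parahoric subgroup of `G(k_v)`, that is, the stabilizer of a vertex of the
building. The vertices correspond to the maximal elements among the `σ`-stable orders: if `v` splits
in `ℓ` these are the orders `R × σ(R)` with `R` a maximal order in one factor of `k_v ⊗ D`; if `v` is
inert and `σ` is adjoint to a hermitian form on `ℓ_v³`, these are the stabilizers of the lattice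
chains `{πⁱM, πⁱM*}` with `πM* ⊆ M ⊆ M*`, where `M*` is the lattice dual to `M` with respect to a
multiple of the form. -/
def IsMaximalParahoric (σ : AlgInvolution k D) (v : HeightOneSpectrum (𝓞 k))
    (P : Subgroup (LocalAlg D v)ˣ) : Prop :=
  ∃ R : Subalgebra (v.adicCompletionIntegers k) (LocalAlg D v),
    IsMaximalStableOrder σ v R ∧ P = localGroup σ v ⊓ unitsOf R

/-- `P` is a hyperspecial parahoric subgroup of `G(k_v)`, for `v` unramified in `ℓ`: `D` is split at
all places over `v` and `P` is the special unitary group of a `σ`-stable maximal order (which then is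
an Azumaya algebra over the unramified extension `o_v ⊗ o_ℓ` of `o_v`, so that this group is the group
of integral points of a reductive model of `G`). -/
def IsHyperspecial (ℓ : Type v) [Field ℓ] [NumberField ℓ] [Algebra k ℓ] [Algebra ℓ D]
    (σ : AlgInvolution k D) (v : HeightOneSpectrum (𝓞 k)) (P : Subgroup (LocalAlg D v)ˣ) : Prop :=
  (∀ w : HeightOneSpectrum (𝓞 ℓ), w.asIdeal.LiesOver v.asIdeal → IsSplitAt D w) ∧
  ∃ R : Subalgebra (v.adicCompletionIntegers k) (LocalAlg D v),
    IsMaximalOrder (v.adicCompletion k) R ∧ IsStable (localInv σ v) R ∧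
    P = localGroup σ v ⊓ unitsOf R

/-- Coherence of a collection of open subgroups `P_v` of `G(k_v)`: their product is open in
the group of finite adelic points of `G`. With respect to the integral structure given by some
(equivalently, any) order of `D`, the group `P_v` contains the integral points of `G` for almost
all `v`. -/
def IsCoherent (σ : AlgInvolution k D)
    (P : ∀ v : HeightOneSpectrum (𝓞 k), Subgroup (LocalAlg D v)ˣ) : Prop :=
  ∃ R : Subalgebra (𝓞 k) D, IsLatticeOrder k R ∧
    ∀ᶠ v : HeightOneSpectrum (𝓞 k) in Filter.cofinite, ∀ g ∈ localGroup σ v,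
      (g : LocalAlg D v) ∈ Submodule.span (v.adicCompletionIntegers k)
        ((fun x : D => (1 : v.adicCompletion k) ⊗ₜ[k] x) '' (R : Set D)) → g ∈ P v

/-- `G(k_v)⁺`, the first congruence subgroup of `G(k_v)` at a place `v` where `k_v ⊗ D` is the
product of two division algebras `𝔇 × 𝔇ᵒᵖ` interchanged by the involution, so that
`G(k_v) = SL₁(𝔇)`: the elements congruent to `1` modulo the radical of the maximal order. At such a
place there is only one maximal order, namely the product of the valuation rings of the two factors;
it is `σ`-stable, and it is the only maximal `σ`-stable order. -/
noncomputable def localGroupPlus (σ : AlgInvolution k D) (v : HeightOneSpectrum (𝓞 k)) :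
    Subgroup (LocalAlg D v)ˣ :=
  localGroup σ v ⊓
    ⨅ (R : Subalgebra (v.adicCompletionIntegers k) (LocalAlg D v))
      (_ : IsMaximalStableOrder σ v R), congruenceUnits R

/-- `Λ = G(k) ∩ ∏_v P_v`. -/
noncomputable def principalSubgroup (σ : AlgInvolution k D)
    (P : ∀ v : HeightOneSpectrum (𝓞 k), Subgroup (LocalAlg D v)ˣ) : Subgroup Dˣ :=
  specialUnitary σ ⊓ ⨅ v, (P v).comap (toLocal D v)

/-- `G(k) ∩ Q ∩ ∏_{v ≠ u} P_v`, for a subgroup `Q` of `G(k_u)`. -/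
noncomputable def principalSubgroupAt (σ : AlgInvolution k D)
    (P : ∀ v : HeightOneSpectrum (𝓞 k), Subgroup (LocalAlg D v)ˣ)
    (u : HeightOneSpectrum (𝓞 k)) (Q : Subgroup (LocalAlg D u)ˣ) : Subgroup Dˣ :=
  specialUnitary σ ⊓ Q.comap (toLocal D u) ⊓ ⨅ (v) (_ : v ≠ u), (P v).comap (toLocal D v)

end Groups

/-!
An element of finite order of `G(k)` that is not central in `D` has a power `h` of prime power order
`q` outside `ℓ`, and `h` generates a cubic extension `K` of `ℓ`. Here `3` divides `φ(q)`, because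
`K / ℓ` is cyclotomic of degree `3`. Moreover `K` contains `ζ_q`, and it contains `ζ₄` and has degree
at most `12` over `ℚ` in the first two cases, while it contains `ζ₂₀` and has degree at most `24` in the
third case; comparing with the degree of the cyclotomic field generated by these roots of unity leaves
only `q = 7` and `q = 9` in the first two cases, and nothing in the third. Here `q = 9` would put a
primitive cube root of unity into `ℓ`, and `q = 7` puts `√-7` into `ℓ`, which is impossible for
`ℓ = ℚ(√15, ζ₄)`. So every element of finite order, or at least its seventh power if
`ℓ = ℚ(√7, ζ₄)`, is central. A central element `c` of reduced norm one satisfies `c³ = 1`, because `D`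
has a homomorphism to the `3 × 3` matrices that is scalar on `ℓ`; so `c = 1`, as `ℓ` contains no
primitive cube root of unity. This gives the assertions on `G(k)`.

The congruence subgroup `G(k_𝔳)⁺` has no `7`-torsion since `7` is invertible in the residue field:
if `g` lies in it, `1 + g + ⋯ + g⁶` is congruent to `7` modulo the radical, hence a unit, so `g⁷ = 1`
forces `g = 1`.

For the groups at a place `v` over `3`, let `g` have order `7` and let `i = ζ₄`. The residue field at
`v` is `𝔽₃`, and `S = o_v[i, g]` is generated by six elements as an `o_v`-module. Its residue fields
contain an element of order `28`, which does not divide `3ᵈ - 1` for `d < 6`; so `S` is the valuation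
ring of the unramified extension of `k_v` of degree `6`. Since the period `g + g² + g⁴` is central,
`D` is a cyclic algebra `F ⊕ F u ⊕ F u²` with `F = k(i, g)` and `u g = g² u`. After multiplication of
`u` by a power of the uniformizer, or replacement by such a multiple of `u²`, the valuation of `u³` is
`0` or `1`. Then `S ⊕ S u ⊕ S u²` is an order stable under the involution, and it contains every order
that contains `S`: the components of an element `t` of such an order are weighted averages of the
`g⁻ᵃ t gᵇ`, so they are again in the order, and the cube of `f u` is integral only if `f ∈ S`. A maximal
stable order `R` containing `g` contains `i`, because `R + R i` is a stable order; therefore `R` is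
`S ⊕ S u ⊕ S u²` and is a maximal order (`IsCyclicDatum.isMaximalOrder`). Hence the parahoric subgroup
defined by `R` is hyperspecial, and a non-hyperspecial one contains no torsion of `G(k)`.
-/

/-! ### Roots of unity in cubic extensions -/

/-- The Galois group of a cyclotomic extension generated by an `n`-th root of unity embeds
in `(ℤ/n)ˣ`. -/
theorem finrank_dvd_totient_of_adjoin_eq_top {F : Type u} {K : Type v} [Field F] [Field K]
    [Algebra F K] {n : ℕ} [NeZero n] {ζ : K} (hζ : IsPrimitiveRoot ζ n)
    (htop : Algebra.adjoin F {ζ} = ⊤) : finrank F K ∣ n.totient := by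
  have hc : IsCyclotomicExtension {n} F K := by
    rw [IsCyclotomicExtension.iff_adjoin_eq_top]
    refine ⟨fun s hs _ ↦ ?_, ?_⟩
    · rw [Set.mem_singleton_iff] at hs
      exact ⟨ζ, hs ▸ hζ⟩
    · refine top_unique (htop.symm.le.trans (Algebra.adjoin_mono ?_))
      rw [Set.singleton_subset_iff]
      exact ⟨n, rfl, NeZero.ne n, hζ.pow_eq_one⟩
  have : FiniteDimensional F K := IsCyclotomicExtension.finiteDimensional {n} F K
  have : IsGalois F K := IsCyclotomicExtension.isGalois {n} F K
  rw [← IsGalois.card_aut_eq_finrank, ← Nat.card_eq_fintype_card.trans (ZMod.card_units_eq_totient n)]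
  exact Subgroup.card_dvd_of_injective _ (hζ.autToPow_injective F)

/-- In a cubic extension, the elements of degree at most two over the base lie in the base. -/
theorem mem_range_of_quadratic_of_finrank_eq_three {F : Type u} {K : Type v} [Field F] [Field K]
    [Algebra F K] (h3 : finrank F K = 3) (b c : F) {x : K}
    (hx : x ^ 2 + algebraMap F K b * x + algebraMap F K c = 0) : x ∈ (algebraMap F K).range := by
  have : FiniteDimensional F K := FiniteDimensional.of_finrank_pos (by omega)
  have hdvd : (minpoly F x).natDegree ∣ 3 := h3 ▸ minpoly.degree_dvd (Algebra.IsIntegral.isIntegral x)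
  have hle : (minpoly F x).natDegree ≤ 2 := by
    have hm : (Polynomial.X ^ 2 + Polynomial.C b * Polynomial.X + Polynomial.C c).Monic := by
      monicity!
    have h := minpoly.min F x hm (by simpa using hx)
    refine Polynomial.natDegree_le_of_degree_le (h.trans ?_)
    compute_degree!
  have h1 : (minpoly F x).natDegree = 1 := by
    rcases (Nat.dvd_prime Nat.prime_three).1 hdvd with h | h <;> omega
  exact minpoly.natDegree_eq_one_iff.1 h1

/-- A quadratic extension `F(t)`, `t² = d`, as the set of the `a + b t`. -/
theorem exists_add_mul_of_adjoin_eq_top {F : Type u} {E : Type v} [Field F] [Field E] [Algebra F E]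
    {t : E} {d : F} (ht : t ^ 2 = algebraMap F E d) (htop : IntermediateField.adjoin F {t} = ⊤)
    (x : E) : ∃ a b : F, x = algebraMap F E a + algebraMap F E b * t := by
  have hint : IsIntegral F t := IsIntegral.of_pow two_pos (ht ▸ isIntegral_algebraMap)
  have hx : x ∈ Algebra.adjoin F {t} := by
    rw [← IntermediateField.adjoin_simple_toSubalgebra_of_isAlgebraic hint.isAlgebraic, htop]
    trivial
  induction hx using Algebra.adjoin_induction with
  | mem y hy => exact ⟨0, 1, by simpa using hy⟩
  | algebraMap r => exact ⟨r, 0, by simp⟩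
  | add y z _ _ hy hz =>
    obtain ⟨a, b, rfl⟩ := hy
    obtain ⟨a', b', rfl⟩ := hz
    exact ⟨a + a', b + b', by simp only [map_add]; ring⟩
  | mul y z _ _ hy hz =>
    obtain ⟨a, b, rfl⟩ := hy
    obtain ⟨a', b', rfl⟩ := hz
    exact ⟨a * a' + b * b' * d, a * b' + a' * b, by
      simp only [map_add, map_mul]; linear_combination algebraMap F E b * algebraMap F E b' * ht⟩

theorem finrank_le_two_of_adjoin_eq_top {F : Type u} {E : Type v} [Field F] [Field E] [Algebra F E]
    {t : E} {d : F} (ht : t ^ 2 = algebraMap F E d) (htop : IntermediateField.adjoin F {t} = ⊤) :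
    finrank F E ≤ 2 := by
  have hspan : Submodule.span F (Set.range ![(1 : E), t]) = ⊤ := by
    refine top_unique fun x _ ↦ ?_
    obtain ⟨a, b, rfl⟩ := exists_add_mul_of_adjoin_eq_top ht htop x
    rw [Submodule.mem_span_range_iff_exists_fun]
    exact ⟨![a, b], by simp [Algebra.smul_def]⟩
  rw [← finrank_top F E, ← hspan]
  exact (finrank_range_le_card (R := F) ![(1 : E), t]).trans_eq (by simp)

/-- The kernel of `Fˣ/Fˣ² → Eˣ/Eˣ²` for `E = F(√d)` is generated by `d`. -/
theorem isSquare_or_isSquare_mul_of_adjoin_eq_top {F : Type u} {E : Type v} [Field F] [CharZero F]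
    [Field E] [Algebra F E] {t : E} {d : F} (ht : t ^ 2 = algebraMap F E d) (hd : ¬ IsSquare d)
    (htop : IntermediateField.adjoin F {t} = ⊤) {c : F} (hc : IsSquare (algebraMap F E c)) :
    IsSquare c ∨ IsSquare (c * d) := by
  obtain ⟨x, hx⟩ := hc
  obtain ⟨a, b, rfl⟩ := exists_add_mul_of_adjoin_eq_top ht htop x
  have hinj := (algebraMap F E).injective
  have hab : a * b = 0 := by
    by_contra hne
    refine hd ⟨(c - a ^ 2 - b ^ 2 * d) / (2 * (a * b)), hinj ?_⟩
    have h2 : algebraMap F E (2 * (a * b)) ≠ 0 := by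
      rw [Ne, map_eq_zero_iff _ hinj]; simpa using hne
    have h3 : t = algebraMap F E ((c - a ^ 2 - b ^ 2 * d) / (2 * (a * b))) := by
      rw [map_div₀, eq_div_iff h2]
      simp only [map_sub, map_mul, map_pow, map_ofNat]
      linear_combination -hx - algebraMap F E b ^ 2 * ht
    rw [map_mul, ← h3, ← ht, sq]
  rcases mul_eq_zero.1 hab with h | h
  · right
    refine ⟨b * d, hinj ?_⟩
    subst h
    simp only [map_mul, map_zero, zero_add] at hx ⊢
    linear_combination algebraMap F E d * hx + algebraMap F E d * algebraMap F E b ^ 2 * ht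
  · left
    refine ⟨a, hinj ?_⟩
    subst h
    simpa using hx

/-- The rational numbers that become squares in `ℚ(√m, i)`. -/
theorem isSquare_rat_of_isSquare_biquadratic {k : Type u} {ℓ : Type v} [Field k] [CharZero k]
    [Field ℓ] [CharZero ℓ] [Algebra k ℓ] {m : ℚ} {s : k} {i : ℓ}
    (hm : 0 < m) (hm' : ¬ IsSquare m) (hs : s ^ 2 = m) (hi : i ^ 2 = -1)
    (hk : IntermediateField.adjoin ℚ {s} = ⊤) (hℓ : IntermediateField.adjoin k {i} = ⊤)
    {c : ℚ} (hc : IsSquare (c : ℓ)) :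
    IsSquare c ∨ IsSquare (c * m) ∨ IsSquare (-c) ∨ IsSquare (-c * m) := by
  have key (c : ℚ) (hc : IsSquare (c : k)) : IsSquare c ∨ IsSquare (c * m) :=
    isSquare_or_isSquare_mul_of_adjoin_eq_top (by simpa using hs) hm' hk (by simpa using hc)
  have hneg : ¬ IsSquare (-1 : k) := by
    intro h
    rcases key (-1) (by simpa using h) with h | h
    · exact absurd h.nonneg (by norm_num)
    · exact absurd h.nonneg (by linarith)
  rcases isSquare_or_isSquare_mul_of_adjoin_eq_top (F := k) (d := -1) (c := c) (by simpa using hi) hneg hℓ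
    (by simpa using hc) with h | h
  · rcases key c h with h | h <;> simp [h]
  · rcases key (-c) (by simpa using h) with h | h
    · exact Or.inr (Or.inr (Or.inl h))
    · exact Or.inr (Or.inr (Or.inr h))

theorem sq_eq_neg_one_of_isPrimitiveRoot_four {F : Type u} [Field F] {i : F}
    (hi : IsPrimitiveRoot i 4) : i ^ 2 = -1 := by
  have h := hi.pow_eq_one
  have h2 := hi.pow_ne_one_of_pos_of_lt (l := 2) (by norm_num) (by norm_num)
  have : (i ^ 2 - 1) * (i ^ 2 + 1) = 0 := by linear_combination h
  rcases mul_eq_zero.1 this with h' | h'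
  · exact absurd (sub_eq_zero.1 h') h2
  · exact eq_neg_of_add_eq_zero_left h'

section Pairs

variable {k : Type u} {ℓ : Type v} [Field k] [NumberField k] [Field ℓ] [NumberField ℓ] [Algebra k ℓ]

theorem IsC20.finrank_le (h : IsC20 k ℓ) : finrank ℚ ℓ ≤ 4 := by
  obtain ⟨s, i, hs, hi, hk, hℓ⟩ := h
  rw [← finrank_mul_finrank ℚ k ℓ]
  exact Nat.mul_le_mul (finrank_le_two_of_adjoin_eq_top (d := 7) (by simpa using hs) hk)
    (finrank_le_two_of_adjoin_eq_top (d := -1)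
      (by simpa using sq_eq_neg_one_of_isPrimitiveRoot_four hi) hℓ)

theorem IsC26.finrank_le (h : IsC26 k ℓ) : finrank ℚ ℓ ≤ 4 := by
  obtain ⟨s, i, hs, hi, hk, hℓ⟩ := h
  rw [← finrank_mul_finrank ℚ k ℓ]
  exact Nat.mul_le_mul (finrank_le_two_of_adjoin_eq_top (d := 15) (by simpa using hs) hk)
    (finrank_le_two_of_adjoin_eq_top (d := -1)
      (by simpa using sq_eq_neg_one_of_isPrimitiveRoot_four hi) hℓ)

omit [NumberField k] in
theorem IsC35.finrank_le (h : IsC35 k ℓ) : finrank ℚ ℓ ≤ 8 := by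
  obtain ⟨ζ, hζ, hℓ, -⟩ := h
  rw [← IntermediateField.finrank_top', ← hℓ,
    IntermediateField.adjoin.finrank (Algebra.IsIntegral.isIntegral ζ),
    ← Polynomial.cyclotomic_eq_minpoly_rat hζ (by norm_num), Polynomial.natDegree_cyclotomic,
    show Nat.totient 20 = 8 by decide +kernel]

theorem IsC20.not_isSquare_neg_three (h : IsC20 k ℓ) : ¬ IsSquare (-3 : ℓ) := by
  obtain ⟨s, i, hs, hi, hk, hℓ⟩ := h
  intro hsq
  have := isSquare_rat_of_isSquare_biquadratic (m := 7) (c := -3) (by norm_num) (by decide +kernel)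
    (by simpa using hs) (sq_eq_neg_one_of_isPrimitiveRoot_four hi) hk hℓ (by simpa using hsq)
  revert this
  decide +kernel

theorem IsC26.not_isSquare_neg_three (h : IsC26 k ℓ) : ¬ IsSquare (-3 : ℓ) := by
  obtain ⟨s, i, hs, hi, hk, hℓ⟩ := h
  intro hsq
  have := isSquare_rat_of_isSquare_biquadratic (m := 15) (c := -3) (by norm_num) (by decide +kernel)
    (by simpa using hs) (sq_eq_neg_one_of_isPrimitiveRoot_four hi) hk hℓ (by simpa using hsq)
  revert this
  decide +kernel

theorem IsC26.not_isSquare_neg_seven (h : IsC26 k ℓ) : ¬ IsSquare (-7 : ℓ) := by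
  obtain ⟨s, i, hs, hi, hk, hℓ⟩ := h
  intro hsq
  have := isSquare_rat_of_isSquare_biquadratic (m := 15) (c := -7) (by norm_num) (by decide +kernel)
    (by simpa using hs) (sq_eq_neg_one_of_isPrimitiveRoot_four hi) hk hℓ (by simpa using hsq)
  revert this
  decide +kernel

theorem eq_one_of_pow_three_of_not_isSquare {F : Type u} [Field F] (h3 : ¬ IsSquare (-3 : F))
    {c : F} (hc : c ^ 3 = 1) : c = 1 := by
  by_contra hne
  have h : c ^ 2 + c + 1 = 0 := by
    have : (c - 1) * (c ^ 2 + c + 1) = 0 := by linear_combination hc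
    exact (mul_eq_zero.1 this).resolve_left (sub_ne_zero.2 hne)
  exact h3 ⟨2 * c + 1, by linear_combination -4 * h⟩

omit [NumberField k] in
theorem IsC35.not_isSquare_neg_three (h : IsC35 k ℓ) : ¬ IsSquare (-3 : ℓ) := by
  intro ⟨x, hx⟩
  have hfin := h.finrank_le
  obtain ⟨ζ, hζ, hℓ, -⟩ := h
  have hω : IsPrimitiveRoot ((x - 1) / 2) 3 := by
    rw [IsPrimitiveRoot.iff_orderOf]
    refine orderOf_eq_prime ?_ ?_
    · field_simp
      linear_combination (3 - x) * hx
    · intro h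
      have : x = 3 := by field_simp at h; linear_combination h
      rw [this] at hx; norm_num at hx
  have := hω.lcm_totient_le_finrank hζ
    (Polynomial.cyclotomic.irreducible_rat (n := Nat.lcm 3 20) (by decide))
  rw [show (Nat.lcm 3 20).totient = 16 by decide +kernel] at this
  omega

omit [NumberField k] in
/-- No root of unity of prime power order generates a cubic extension of `ℚ(ζ₂₀)`. -/
theorem not_isPrimitiveRoot_primePow_of_isC35 (h : IsC35 k ℓ) {K : Type w} [Field K] [Algebra ℓ K]
    (h3 : finrank ℓ K = 3) {p a : ℕ} (hp : p.Prime) {x : K} (hx : IsPrimitiveRoot x (p ^ a))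
    (htop : Algebra.adjoin ℓ {x} = ⊤) : False := by
  have hfin := h.finrank_le
  obtain ⟨ζ, hζ, -, -⟩ := h
  have : NeZero (p ^ a) := ⟨(pow_pos hp.pos a).ne'⟩
  have : CharZero K := charZero_of_injective_algebraMap (algebraMap ℓ K).injective
  have : FiniteDimensional ℓ K := FiniteDimensional.of_finrank_pos (by omega)
  have : FiniteDimensional ℚ K := FiniteDimensional.trans ℚ ℓ K
  have hdvd := finrank_dvd_totient_of_adjoin_eq_top hx htop
  rw [h3] at hdvd
  have ha : a ≠ 0 := by rintro rfl; simp at hdvd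
  have hpos : 0 < (p ^ a).totient := Nat.totient_pos.2 (pow_pos hp.pos a)
  have hle := hx.lcm_totient_le_finrank (hζ.map_of_injective (algebraMap ℓ K).injective)
    (Polynomial.cyclotomic.irreducible_rat (Nat.lcm_pos (pow_pos hp.pos a) (by norm_num)))
  rw [← finrank_mul_finrank ℚ ℓ K, h3] at hle
  by_cases hcop : (p ^ a).Coprime 20
  · rw [hcop.lcm_eq_mul, Nat.totient_mul hcop, show Nat.totient 20 = 8 by decide +kernel] at hle
    have h2 : 2 < p ^ a := by
      by_contra hlt
      have hpa : 0 < p ^ a := pow_pos hp.pos a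
      have : p ^ a = 1 ∨ p ^ a = 2 := by omega
      rcases this with h | h <;> rw [h] at hdvd <;> revert hdvd <;> decide
    have := (Nat.totient_even h2).two_dvd
    omega
  · -- for `p = 2` and `p = 5` the group `(ℤ/pᵃ)ˣ` has no element of order `3`
    have hp20 : p ∣ 20 := by
      by_contra hndvd
      exact hcop (Nat.Coprime.pow_left a ((Nat.Prime.coprime_iff_not_dvd hp).2 hndvd))
    rw [Nat.totient_prime_pow hp (Nat.pos_of_ne_zero ha)] at hdvd
    have hp25 : p = 2 ∨ p = 5 := by
      have : p ∣ 2 ^ 2 * 5 := hp20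
      rcases (Nat.Prime.dvd_mul hp).1 this with h | h
      · exact Or.inl ((Nat.prime_dvd_prime_iff_eq hp Nat.prime_two).1 (hp.dvd_of_dvd_pow h))
      · exact Or.inr ((Nat.prime_dvd_prime_iff_eq hp Nat.prime_five).1 h)
    rcases (Nat.Prime.dvd_mul Nat.prime_three).1 hdvd with h | h
    · have := (Nat.prime_dvd_prime_iff_eq Nat.prime_three hp).1 (Nat.prime_three.dvd_of_dvd_pow h)
      omega
    · rcases hp25 with rfl | rfl <;> revert h <;> decide

/-- The period `x + x² + x⁴` of a seventh root of unity is a root of `X² + X + 2`. -/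
theorem quadratic_period_seven {R : Type u} [CommRing R] {x : R}
    (hx : 1 + x + x ^ 2 + x ^ 3 + x ^ 4 + x ^ 5 + x ^ 6 = 0) :
    (x + x ^ 2 + x ^ 4) ^ 2 + (x + x ^ 2 + x ^ 4) + 2 = 0 := by
  linear_combination (x ^ 2 - x + 2) * hx

/-- A root of unity of prime power order that generates a cubic extension of a field `ℓ ∋ ζ₄` of
degree at most four has order `7`; the order `9` is excluded by the absence of cube roots of unity. -/
theorem eq_seven_of_isPrimitiveRoot_primePow (hfin : finrank ℚ ℓ ≤ 4) {i : ℓ}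
    (hi : IsPrimitiveRoot i 4) (hsq : ¬ IsSquare (-3 : ℓ)) {K : Type w} [Field K] [Algebra ℓ K]
    (h3 : finrank ℓ K = 3) {p a : ℕ} (hp : p.Prime) {x : K} (hx : IsPrimitiveRoot x (p ^ a))
    (htop : Algebra.adjoin ℓ {x} = ⊤) :
    p ^ a = 7 ∧ x + x ^ 2 + x ^ 4 ∈ (algebraMap ℓ K).range := by
  have : NeZero (p ^ a) := ⟨(pow_pos hp.pos a).ne'⟩
  have : CharZero K := charZero_of_injective_algebraMap (algebraMap ℓ K).injective
  have : FiniteDimensional ℓ K := FiniteDimensional.of_finrank_pos (by omega)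
  have : FiniteDimensional ℚ K := FiniteDimensional.trans ℚ ℓ K
  have hdvd := finrank_dvd_totient_of_adjoin_eq_top hx htop
  rw [h3] at hdvd
  have ha : a ≠ 0 := by rintro rfl; simp at hdvd
  obtain ⟨b, rfl⟩ : ∃ b, a = b + 1 := ⟨a - 1, by omega⟩
  have hle := hx.lcm_totient_le_finrank (hi.map_of_injective (algebraMap ℓ K).injective)
    (Polynomial.cyclotomic.irreducible_rat (Nat.lcm_pos (pow_pos hp.pos _) (by norm_num)))
  rw [← finrank_mul_finrank ℚ ℓ K, h3] at hle
  have hpos : 0 < (p ^ (b + 1)).totient := Nat.totient_pos.2 (pow_pos hp.pos _)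
  have hp2 : p ≠ 2 := by
    rintro rfl
    rw [Nat.totient_prime_pow hp (Nat.succ_pos b)] at hdvd
    have := Nat.prime_three.dvd_of_dvd_pow (by simpa using hdvd : 3 ∣ 2 ^ b)
    omega
  have hcop : (p ^ (b + 1)).Coprime 4 := by
    refine Nat.Coprime.pow_left _ ((Nat.Prime.coprime_iff_not_dvd hp).2 fun h ↦ hp2 ?_)
    exact (Nat.prime_dvd_prime_iff_eq hp Nat.prime_two).1 (hp.dvd_of_dvd_pow (n := 2) h)
  rw [hcop.lcm_eq_mul, Nat.totient_mul hcop, show Nat.totient 4 = 2 by decide +kernel] at hle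
  have htot : p ^ b * (p - 1) = 3 ∨ p ^ b * (p - 1) = 6 := by
    rw [← Nat.totient_prime_pow_succ hp]; omega
  have hple : p ≤ 7 := by
    have h1 : 1 ≤ p ^ b := Nat.one_le_pow _ _ hp.pos
    have h2 : p - 1 ≤ p ^ b * (p - 1) := Nat.le_mul_of_pos_left _ h1
    omega
  have hcase : p ^ (b + 1) = 7 ∨ p ^ (b + 1) = 9 := by
    have hp' := hp.two_le
    rw [pow_succ]
    interval_cases p
    · omega
    · right; omega
    · exact absurd hp (by decide)
    · omega
    · exact absurd hp (by decide)
    · left; omega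
  rcases hcase with h7 | h9
  · refine ⟨h7, ?_⟩
    rw [h7] at hx
    refine mem_range_of_quadratic_of_finrank_eq_three h3 1 2 ?_
    have := hx.geom_sum_eq_zero (by norm_num)
    simp only [Finset.sum_range_succ, Finset.sum_range_zero, zero_add, pow_zero, pow_one] at this
    rw [map_one, map_ofNat, one_mul]
    exact quadratic_period_seven this
  · exfalso
    rw [h9] at hx
    have hω : IsPrimitiveRoot (x ^ 3) 3 := hx.pow (by norm_num) (by norm_num)
    have hsum := hω.geom_sum_eq_zero (by norm_num)
    simp only [Finset.sum_range_succ, Finset.sum_range_zero, zero_add, pow_zero, pow_one] at hsum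
    obtain ⟨c, hc⟩ := mem_range_of_quadratic_of_finrank_eq_three h3 (x := x ^ 3) 1 1
      (by rw [map_one]; linear_combination hsum)
    refine hsq ⟨2 * c + 1, (algebraMap ℓ K).injective ?_⟩
    simp only [map_mul, map_add, map_one, map_neg, map_ofNat, hc]
    linear_combination -4 * hsum

end Pairs

/-! ### Subfields of a cubic division algebra -/

section Subfields

variable {ℓ : Type v} {D : Type w} [Field ℓ] [DivisionRing D] [Algebra ℓ D]

/-- The structure of a right vector space on `D` over a field `K` embedded in `D`. -/
@[reducible]
def rightModule {K : Type u} [Field K] [Algebra ℓ K] (f : K →ₐ[ℓ] D) : Module K D :=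
  Module.compHom D ((f : K →+* D).toOpposite fun x y ↦ by
    rw [commute_iff_eq, ← map_mul, ← map_mul, mul_comm])

theorem rightModule_smul_def {K : Type u} [Field K] [Algebra ℓ K] (f : K →ₐ[ℓ] D) (c : K) (x : D) :
    letI := rightModule f
    c • x = x * f c := rfl

theorem rightModule_isScalarTower {K : Type u} [Field K] [Algebra ℓ K] (f : K →ₐ[ℓ] D) :
    letI := rightModule f
    IsScalarTower ℓ K D := by
  let := rightModule f
  refine ⟨fun a c x ↦ ?_⟩
  rw [rightModule_smul_def, rightModule_smul_def, map_smul, mul_smul_comm]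

/-- The degree of a subfield divides `9`, and it is not `9` since `D` is not commutative. -/
theorem finrank_eq_three_of_embedding [Algebra.IsCentral ℓ D] (h9 : finrank ℓ D = 9) {K : Type u}
    [Field K] [Algebra ℓ K] (f : K →ₐ[ℓ] D) (h1 : finrank ℓ K ≠ 1) : finrank ℓ K = 3 := by
  let := rightModule f
  have := rightModule_isScalarTower f
  have hmul := finrank_mul_finrank ℓ K D
  rw [h9] at hmul
  have hfin : FiniteDimensional ℓ D := FiniteDimensional.of_finrank_pos (by omega)
  obtain ⟨j, hj, hK⟩ := (Nat.dvd_prime_pow Nat.prime_three (m := 2)).1 ⟨_, hmul.symm⟩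
  interval_cases j
  · exact absurd hK h1
  · exact hK
  · exfalso
    have hsurj : Function.Surjective f := by
      have : FiniteDimensional ℓ K := FiniteDimensional.of_finrank_pos (by omega)
      exact (LinearMap.injective_iff_surjective_of_finrank_eq_finrank (f := f.toLinearMap)
        (by rw [hK, h9]; norm_num)).1 (f : K →+* D).injective
    have htop : (⊥ : Subalgebra ℓ D) = ⊤ := by
      refine top_unique fun x _ ↦ Algebra.IsCentral.out (Subalgebra.mem_center_iff.2 fun y ↦ ?_)
      obtain ⟨x, rfl⟩ := hsurj x
      obtain ⟨y, rfl⟩ := hsurj y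
      rw [← map_mul, ← map_mul, mul_comm]
    have := Subalgebra.bot_eq_top_iff_finrank_eq_one.1 htop
    omega

/-- A noncentral element of `D` generates a cubic extension of the center. -/
theorem exists_cubic_subfield [Algebra.IsCentral ℓ D] (h9 : finrank ℓ D = 9) {d : D}
    (hd : d ∉ (algebraMap ℓ D).range) :
    ∃ (K : Type v) (_ : Field K) (_ : Algebra ℓ K) (f : K →ₐ[ℓ] D) (x : K),
      f x = d ∧ finrank ℓ K = 3 ∧ Algebra.adjoin ℓ {x} = ⊤ := by
  have hfin : FiniteDimensional ℓ D := FiniteDimensional.of_finrank_pos (by omega)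
  have hint : IsIntegral ℓ d := Algebra.IsIntegral.isIntegral d
  have : Fact (Irreducible (minpoly ℓ d)) := ⟨minpoly.irreducible hint⟩
  let f : AdjoinRoot (minpoly ℓ d) →ₐ[ℓ] D :=
    Ideal.Quotient.liftₐ (Ideal.span {minpoly ℓ d}) (Polynomial.aeval d) fun a ha ↦ by
      obtain ⟨q, rfl⟩ := Ideal.mem_span_singleton'.1 ha
      rw [map_mul, minpoly.aeval, mul_zero]
  have hf : f (AdjoinRoot.root (minpoly ℓ d)) = d :=
    Polynomial.aeval_X d
  refine ⟨AdjoinRoot (minpoly ℓ d), inferInstance, inferInstance, f, AdjoinRoot.root _, hf, ?_,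
    AdjoinRoot.adjoinRoot_eq_top⟩
  refine finrank_eq_three_of_embedding h9 f fun h1 ↦ hd ?_
  rw [(AdjoinRoot.powerBasis (minpoly.ne_zero hint)).finrank, AdjoinRoot.powerBasis_dim,
    minpoly.natDegree_eq_one_iff] at h1
  exact h1

/-- A cubic subfield `K` of `D` splits `D`, through the action of `D` by left multiplications on
the right `K`-vector space `D`. -/
theorem exists_algHom_matrix_of_embedding (h9 : finrank ℓ D = 9) {K : Type u}
    [Field K] [Algebra ℓ K] (f : K →ₐ[ℓ] D) (h3 : finrank ℓ K = 3) :
    Nonempty (D →ₐ[ℓ] Matrix (Fin 3) (Fin 3) K) := by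
  let := rightModule f
  have := rightModule_isScalarTower f
  have : SMulCommClass D K D := ⟨fun a c x ↦ by
    rw [rightModule_smul_def, rightModule_smul_def, smul_eq_mul, smul_eq_mul, mul_assoc]⟩
  have hmul := finrank_mul_finrank ℓ K D
  rw [h9, h3] at hmul
  have hK : finrank K D = 3 := by omega
  have : FiniteDimensional K D := FiniteDimensional.of_finrank_pos (by omega)
  let b : Basis (Fin 3) K D := finBasisOfFinrankEq K D hK
  exact ⟨((algEquivMatrix b).toAlgHom.restrictScalars ℓ).comp (Algebra.lsmul ℓ K D)⟩

theorem exists_notMem_range [Algebra.IsCentral ℓ D] (h9 : finrank ℓ D = 9) :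
    ∃ d : D, d ∉ (algebraMap ℓ D).range := by
  by_contra! h
  have htop : (⊥ : Subalgebra ℓ D) = ⊤ := top_unique fun x _ ↦ h x
  have := Subalgebra.bot_eq_top_iff_finrank_eq_one.1 htop
  omega

/-- The reduced norm of an element `c` of the center is `c³`. -/
theorem pow_three_eq_one_of_mem_reducedNormOne [Algebra.IsCentral ℓ D] (h9 : finrank ℓ D = 9)
    {k : Type u} [Field k] [Algebra k ℓ] [Algebra k D] [IsScalarTower k ℓ D]
    [Algebra.IsAlgebraic k ℓ] {z : Dˣ} (hz : z ∈ reducedNormOne k D) {c : ℓ}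
    (hc : algebraMap ℓ D c = z) : c ^ 3 = 1 := by
  obtain ⟨d, hd⟩ := exists_notMem_range h9
  obtain ⟨K, _, _, f, -, -, h3, -⟩ := exists_cubic_subfield h9 hd
  obtain ⟨Φ⟩ := exists_algHom_matrix_of_embedding h9 f h3
  have : FiniteDimensional ℓ K := FiniteDimensional.of_finrank_pos (by omega)
  let : Algebra k K := Algebra.compHom K (algebraMap k ℓ)
  have : IsScalarTower k ℓ K := .of_algebraMap_eq fun _ ↦ rfl
  have : Algebra.IsAlgebraic k K := Algebra.IsAlgebraic.trans k ℓ K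
  let ι : K →ₐ[k] AlgebraicClosure k := IsAlgClosed.lift
  let Ψ : D →ₐ[k] Matrix (Fin 3) (Fin 3) (AlgebraicClosure k) :=
    ι.mapMatrix.comp (Φ.restrictScalars k)
  have h := Subgroup.mem_iInf.1 hz Ψ
  rw [MonoidHom.mem_ker, Units.ext_iff] at h
  replace h : (Ψ (z : D)).det = 1 := h
  have hΨ : Ψ (z : D) = ι.mapMatrix (algebraMap K _ (algebraMap ℓ K c)) := by
    change ι.mapMatrix (Φ (z : D)) = _
    rw [← hc, AlgHom.commutes]; rfl
  have hdet : (algebraMap K (Matrix (Fin 3) (Fin 3) K) (algebraMap ℓ K c)).det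
      = algebraMap ℓ K c ^ 3 := by
    rw [Matrix.algebraMap_eq_diagonal]; simp
  rw [hΨ, ← AlgHom.map_det, hdet] at h
  apply (algebraMap ℓ K).injective
  apply (ι : K →+* AlgebraicClosure k).injective
  simpa using h

/-- Modulo a normal subgroup `N`, the element `g` has the order of the product of its components of
prime power order; `m` is a multiple of that order if the components outside `N` have distinct prime
orders dividing `m`. -/
theorem pow_mem_of_orderOf_prime_components {M : Type u} [Group M] (N : Subgroup M) [N.Normal] {g : M}
    (hg : IsOfFinOrder g) {m : ℕ} (hm : m ≠ 0)
    (H : ∀ (p a : ℕ), p.Prime → ∀ j : ℕ, orderOf (g ^ j) = p ^ a → g ^ j ∉ N → p ^ a = p ∧ p ∣ m) :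
    g ^ m ∈ N := by
  have hn : orderOf g ≠ 0 := hg.orderOf_pos.ne'
  set d := orderOf (g : M ⧸ N) with hd
  have hmem (j : ℕ) : g ^ j ∈ N ↔ d ∣ j := by
    rw [hd, orderOf_dvd_iff_pow_eq_one, ← QuotientGroup.mk_pow, QuotientGroup.eq_one_iff]
  have hdn : d ∣ orderOf g := (hmem _).1 (by rw [pow_orderOf_eq_one]; exact N.one_mem)
  rw [hmem]
  have hd0 : d ≠ 0 := ne_zero_of_dvd_ne_zero hn hdn
  refine (Nat.factorization_prime_le_iff_dvd hd0 hm).1 fun p hp ↦ ?_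
  by_cases hpd : p ∣ d
  · have hord : orderOf (g ^ (orderOf g / p ^ (orderOf g).factorization p))
        = p ^ (orderOf g).factorization p := by
      rw [orderOf_pow_of_dvd (Nat.div_pos (Nat.ordProj_le _ hn) (pow_pos hp.pos _)).ne'
        (Nat.div_dvd_of_dvd (Nat.ordProj_dvd _ _)), Nat.div_div_self (Nat.ordProj_dvd _ _) hn]
    obtain ⟨h1, h2⟩ := H p _ hp _ hord fun hN ↦
      Nat.not_dvd_ordCompl hp hn (hpd.trans ((hmem _).1 hN))
    calc d.factorization p ≤ (orderOf g).factorization p :=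
          (Nat.factorization_le_iff_dvd hd0 hn).2 hdn p
      _ = 1 := Nat.pow_right_injective hp.two_le (h1.trans (pow_one p).symm)
      _ ≤ m.factorization p := hp.factorization_pos_of_dvd hm h2
  · rw [Nat.factorization_eq_zero_of_not_dvd hpd]
    exact Nat.zero_le _

theorem mem_center_units_iff [Algebra.IsCentral ℓ D] {g : Dˣ} :
    g ∈ Subgroup.center Dˣ ↔ (g : D) ∈ (algebraMap ℓ D).range := by
  constructor
  · intro h
    refine Algebra.IsCentral.out (K := ℓ) (Subalgebra.mem_center_iff.2 fun y ↦ ?_)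
    by_cases hy : y = 0
    · simp [hy]
    · exact congrArg Units.val (Subgroup.mem_center_iff.1 h (Units.mk0 y hy))
  · rintro ⟨c, hc⟩
    rw [Subgroup.mem_center_iff]
    intro y
    ext
    rw [Units.val_mul, Units.val_mul, ← hc, Algebra.commutes]

/-- A noncentral root of unity of prime power order in `D` generates a cyclotomic cubic extension
of the center. -/
theorem exists_cubic_subfield_of_orderOf [Algebra.IsCentral ℓ D] (h9 : finrank ℓ D = 9) {g : Dˣ}
    {n : ℕ} (hg : orderOf g = n) (hc : (g : D) ∉ (algebraMap ℓ D).range) :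
    ∃ (K : Type v) (_ : Field K) (_ : Algebra ℓ K) (f : K →ₐ[ℓ] D) (x : K),
      f x = g ∧ finrank ℓ K = 3 ∧ Algebra.adjoin ℓ {x} = ⊤ ∧ IsPrimitiveRoot x n := by
  obtain ⟨K, _, _, f, x, hx, h3, htop⟩ := exists_cubic_subfield h9 hc
  refine ⟨K, _, _, f, x, hx, h3, htop, ?_⟩
  rw [IsPrimitiveRoot.iff_orderOf, ← hg, ← orderOf_units, ← hx]
  exact (orderOf_injective (f : K →* D) (f : K →+* D).injective x).symm

variable {k : Type u} [Field k] [NumberField k] [NumberField ℓ] [Algebra k ℓ]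

omit [NumberField k] in
theorem mem_range_of_isC35 (h : IsC35 k ℓ) [Algebra.IsCentral ℓ D] (h9 : finrank ℓ D = 9) {g : Dˣ}
    (hg : IsOfFinOrder g) : (g : D) ∈ (algebraMap ℓ D).range := by
  rw [← mem_center_units_iff, ← pow_one g]
  refine pow_mem_of_orderOf_prime_components _ hg one_ne_zero fun p a hp j hj hN ↦ ?_
  rw [mem_center_units_iff (ℓ := ℓ)] at hN
  obtain ⟨K, _, _, f, x, -, h3, htop, hx⟩ := exists_cubic_subfield_of_orderOf h9 hj hN
  exact (not_isPrimitiveRoot_primePow_of_isC35 h h3 hp hx htop).elim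

theorem mem_range_of_isC26 (h : IsC26 k ℓ) [Algebra.IsCentral ℓ D] (h9 : finrank ℓ D = 9) {g : Dˣ}
    (hg : IsOfFinOrder g) : (g : D) ∈ (algebraMap ℓ D).range := by
  rw [← mem_center_units_iff, ← pow_one g]
  refine pow_mem_of_orderOf_prime_components _ hg one_ne_zero fun p a hp j hj hN ↦ ?_
  rw [mem_center_units_iff (ℓ := ℓ)] at hN
  obtain ⟨K, _, _, f, x, -, h3, htop, hx⟩ := exists_cubic_subfield_of_orderOf h9 hj hN
  obtain ⟨-, i, -, hi, -, -⟩ := id h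
  obtain ⟨h7, η, hη⟩ := eq_seven_of_isPrimitiveRoot_primePow h.finrank_le hi
    h.not_isSquare_neg_three h3 hp hx htop
  rw [h7] at hx
  have hsum := hx.geom_sum_eq_zero (by norm_num)
  simp only [Finset.sum_range_succ, Finset.sum_range_zero, zero_add, pow_zero, pow_one] at hsum
  refine (h.not_isSquare_neg_seven ⟨2 * η + 1, (algebraMap ℓ K).injective ?_⟩).elim
  simp only [map_mul, map_add, map_one, map_neg, map_ofNat, hη]
  linear_combination -4 * quadratic_period_seven hsum

theorem pow_seven_mem_range_of_isC20 (h : IsC20 k ℓ) [Algebra.IsCentral ℓ D] (h9 : finrank ℓ D = 9)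
    {g : Dˣ} (hg : IsOfFinOrder g) : ((g ^ 7 : Dˣ) : D) ∈ (algebraMap ℓ D).range := by
  rw [← mem_center_units_iff]
  refine pow_mem_of_orderOf_prime_components _ hg (by norm_num) fun p a hp j hj hN ↦ ?_
  rw [mem_center_units_iff (ℓ := ℓ)] at hN
  obtain ⟨K, _, _, f, x, -, h3, htop, hx⟩ := exists_cubic_subfield_of_orderOf h9 hj hN
  obtain ⟨-, i, -, hi, -, -⟩ := id h
  obtain ⟨h7, -⟩ := eq_seven_of_isPrimitiveRoot_primePow h.finrank_le hi
    h.not_isSquare_neg_three h3 hp hx htop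
  have hp7 : p = 7 := (Nat.prime_dvd_prime_iff_eq hp (by norm_num)).1
    (h7 ▸ dvd_pow_self p (by rintro rfl; simp at h7))
  rw [h7, hp7]
  exact ⟨rfl, dvd_rfl⟩

end Subfields

/-! ### Elements of finite order in the special unitary group -/

section Torsion

variable {k : Type u} {ℓ : Type v} {D : Type w} [Field k] [NumberField k] [Field ℓ] [NumberField ℓ]
  [Algebra k ℓ] [DivisionRing D] [Algebra k D] [Algebra ℓ D] [IsScalarTower k ℓ D]

theorem eq_one_of_mem_range_of_mem_specialUnitary (hsq : ¬ IsSquare (-3 : ℓ))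
    [Algebra.IsCentral ℓ D] (h9 : finrank ℓ D = 9) {σ : AlgInvolution k D} {g : Dˣ}
    (hg : g ∈ specialUnitary σ) (hc : (g : D) ∈ (algebraMap ℓ D).range) : g = 1 := by
  have : Algebra.IsAlgebraic k ℓ := Algebra.IsAlgebraic.tower_top (K := ℚ) k
  obtain ⟨c, hc⟩ := hc
  have h := eq_one_of_pow_three_of_not_isSquare hsq
    (pow_three_eq_one_of_mem_reducedNormOne h9 hg.2 hc)
  ext
  rw [← hc, h, map_one, Units.val_one]

theorem isTorsionFreeSubgroup_specialUnitary_of_isC26 (h : IsC26 k ℓ) [Algebra.IsCentral ℓ D]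
    (h9 : finrank ℓ D = 9) (σ : AlgInvolution k D) : IsTorsionFreeSubgroup (specialUnitary σ) :=
  fun _ hg hfin ↦ eq_one_of_mem_range_of_mem_specialUnitary h.not_isSquare_neg_three h9 hg
    (mem_range_of_isC26 h h9 hfin)

theorem isTorsionFreeSubgroup_specialUnitary_of_isC35 (h : IsC35 k ℓ) [Algebra.IsCentral ℓ D]
    (h9 : finrank ℓ D = 9) (σ : AlgInvolution k D) : IsTorsionFreeSubgroup (specialUnitary σ) :=
  fun _ hg hfin ↦ eq_one_of_mem_range_of_mem_specialUnitary h.not_isSquare_neg_three h9 hg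
    (mem_range_of_isC35 h h9 hfin)

theorem orderOf_eq_seven_of_isC20 (h : IsC20 k ℓ) [Algebra.IsCentral ℓ D]
    (h9 : finrank ℓ D = 9) {σ : AlgInvolution k D} {g : Dˣ} (hg : g ∈ specialUnitary σ)
    (hfin : IsOfFinOrder g) (h1 : g ≠ 1) : orderOf g = 7 := by
  have : Fact (Nat.Prime 7) := ⟨by norm_num⟩
  exact orderOf_eq_prime (eq_one_of_mem_range_of_mem_specialUnitary h.not_isSquare_neg_three h9
    (pow_mem hg 7) (pow_seven_mem_range_of_isC20 h h9 hfin)) h1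

end Torsion

/-! ### Torsion in the congruence subgroup -/

/-- The kernel of reduction modulo the Jacobson radical has no `n`-torsion if `n` is invertible:
`1 + x + ⋯ + xⁿ⁻¹` is congruent to `n`, hence invertible. -/
theorem eq_one_of_pow_eq_one_of_sub_one_mem_jacobson {R : Type u} [Ring R] {x : R} {n : ℕ}
    (hx : x - 1 ∈ Ring.jacobson R) (hn : x ^ n = 1) (hu : IsUnit (n : R)) : x = 1 := by
  obtain ⟨c, hc⟩ := hu.exists_left_inv
  have hpow (m : ℕ) : x ^ m - 1 ∈ Ring.jacobson R := by
    rw [← geom_sum_mul]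
    exact Ideal.mul_mem_left _ _ hx
  have hsum : ∑ m ∈ Finset.range n, x ^ m - n ∈ Ring.jacobson R := by
    have : ∑ m ∈ Finset.range n, x ^ m - (n : R) = ∑ m ∈ Finset.range n, (x ^ m - 1) := by simp
    rw [this]
    exact sum_mem fun m _ ↦ hpow m
  have hJ := Ideal.mul_mem_left _ c hsum
  rw [← Ideal.jacobson_bot, Ideal.mem_jacobson_iff] at hJ
  obtain ⟨z, hz⟩ := hJ 1
  rw [Ideal.mem_bot, mul_one, mul_sub, hc, mul_sub, mul_one, sub_add_cancel, sub_eq_zero] at hz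
  have h0 : (∑ m ∈ Finset.range n, x ^ m) * (x - 1) = 0 := by rw [geom_sum_mul, hn, sub_self]
  rw [← sub_eq_zero]
  calc x - 1 = z * (c * ∑ m ∈ Finset.range n, x ^ m) * (x - 1) := by rw [hz, one_mul]
    _ = 0 := by rw [mul_assoc, mul_assoc, h0, mul_zero, mul_zero]

section Local

variable {k : Type u} {ℓ : Type v} {D : Type w} [Field k] [NumberField k] [Field ℓ]
  [NumberField ℓ] [Algebra k ℓ] [DivisionRing D] [Algebra k D] [Algebra ℓ D]

theorem toLocal_injective (v : HeightOneSpectrum (𝓞 k)) : Function.Injective (toLocal D v) :=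
  Units.map_injective
    (Algebra.TensorProduct.includeRight_injective (algebraMap k (v.adicCompletion k)).injective)

theorem isUnit_natCast_adicCompletionIntegers {v : HeightOneSpectrum (𝓞 k)} {n : ℕ}
    (hn : (n : 𝓞 k) ∉ v.asIdeal) : IsUnit (n : v.adicCompletionIntegers k) := by
  rw [HeightOneSpectrum.adicCompletionIntegers.isUnit_iff_valued_eq_one]
  have h := HeightOneSpectrum.valuedAdicCompletion_eq_valuation (K := k) v (n : 𝓞 k)
  rw [(HeightOneSpectrum.valuation_eq_one_iff_notMem v (K := k)).2 hn] at h
  rw [← h]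
  congr 1
  simp

theorem isTorsionFreeSubgroup_congruence {σ : AlgInvolution k D} {v : HeightOneSpectrum (𝓞 k)}
    (h2 : (2 : 𝓞 k) ∈ v.asIdeal)
    (h7 : ∀ g ∈ specialUnitary σ, IsOfFinOrder g → g ≠ 1 → orderOf g = 7)
    (P : ∀ v : HeightOneSpectrum (𝓞 k), Subgroup (LocalAlg D v)ˣ)
    (hP : IsMaximalParahoric σ v (P v)) :
    IsTorsionFreeSubgroup (principalSubgroup σ P ⊓ (localGroupPlus σ v).comap (toLocal D v)) := by
  rintro g ⟨hg, hgp⟩ hfin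
  by_contra hne
  have hord := h7 g hg.1 hfin hne
  obtain ⟨R, hR, -⟩ := hP
  have hmem := Subgroup.mem_iInf.1 (Subgroup.mem_iInf.1 hgp.2 R) hR
  obtain ⟨x, hx, hxg⟩ := hmem
  apply hne
  have hinj : Function.Injective (Units.map (R.val : R →* LocalAlg D v)) :=
    Units.map_injective Subtype.val_injective
  apply toLocal_injective v
  rw [map_one, ← hxg, map_eq_one_iff _ hinj]
  have hpow : x ^ 7 = 1 := by
    apply hinj
    rw [map_pow, hxg, ← map_pow, ← hord, pow_orderOf_eq_one, map_one, map_one]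
  have hunit : IsUnit ((7 : ℕ) : R) := by
    have h7v : ((7 : ℕ) : 𝓞 k) ∉ v.asIdeal := fun h ↦ v.isPrime.ne_top <| by
      rw [Ideal.eq_top_iff_one]
      have := sub_mem h (Ideal.mul_mem_left _ 3 h2)
      norm_num at this
      exact this
    have := (isUnit_natCast_adicCompletionIntegers h7v).map
      (algebraMap (v.adicCompletionIntegers k) R)
    rwa [map_natCast] at this
  ext1
  refine eq_one_of_pow_eq_one_of_sub_one_mem_jacobson (n := 7) ?_ ?_ hunit
  · rw [SetLike.mem_coe, MonoidHom.mem_ker, Units.ext_iff] at hx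
    exact Ideal.Quotient.eq.1 (hx.trans (map_one _).symm)
  · rw [← Units.val_pow_eq_pow_val, hpow, Units.val_one]

end Local

/-! ### An unramified extension of degree six of a `3`-adic ring -/

/-- A finite field of characteristic three with at most `3⁶` elements containing primitive
fourth and seventh roots of unity has `3⁶` elements. -/
theorem card_eq_of_charP_three {F : Type u} [Field F] [Finite F] (h3 : (3 : F) = 0) {i g : F}
    (hi : i * i = -1) (hg : ∑ j ∈ Finset.range 7, g ^ j = 0) (hle : Nat.card F ≤ 3 ^ 6) :
    Nat.card F = 3 ^ 6 := by
  have : Fintype F := Fintype.ofFinite F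
  have : Fact (Nat.Prime 3) := ⟨Nat.prime_three⟩
  have : Fact (Nat.Prime 7) := ⟨by norm_num⟩
  have : CharP F 3 := by
    obtain ⟨p, hp⟩ := CharP.exists F
    have hdvd : p ∣ 3 := (CharP.cast_eq_zero_iff F p 3).1 (by exact_mod_cast h3)
    rcases (Nat.dvd_prime Nat.prime_three).1 hdvd with h | h
    · exact absurd h (CharP.char_ne_one F p)
    · exact h ▸ hp
  obtain ⟨n, -, hn⟩ := FiniteField.card F 3
  rw [Nat.card_eq_fintype_card, hn] at hle ⊢
  have hn6 : (n : ℕ) ≤ 6 := (Nat.pow_le_pow_iff_right (by norm_num)).1 hle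
  have hdvd (a : F) (ha : a ≠ 0) : orderOf a ∣ 3 ^ (n : ℕ) - 1 :=
    orderOf_dvd_of_pow_eq_one (hn ▸ FiniteField.pow_card_sub_one_eq_one a ha)
  have hi4 : orderOf i = 2 ^ (1 + 1) := by
    refine orderOf_eq_prime_pow ?_ ?_
    · intro h
      have h1 : (1 : F) = 0 := by linear_combination h3 + h - hi
      exact one_ne_zero h1
    · linear_combination (i ^ 2 - 1) * hi
  have hg7 : orderOf g = 7 := by
    refine orderOf_eq_prime ?_ ?_
    · rw [← sub_eq_zero, ← geom_sum_mul, hg, zero_mul]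
    · rintro rfl
      have h1 : (1 : F) = 0 := by
        simp only [one_pow, Finset.sum_const, Finset.card_range, nsmul_eq_mul, mul_one] at hg
        push_cast at hg
        linear_combination hg - 2 * h3
      exact one_ne_zero h1
  have h4 := hdvd i (by rintro rfl; simp at hi)
  have h7 := hdvd g (by rintro rfl; simp [Finset.sum_range_succ] at hg)
  rw [hi4] at h4
  rw [hg7] at h7
  have hn0 := n.pos
  generalize (n : ℕ) = m at *
  interval_cases m <;> first | rfl | (exfalso; revert h4 h7; decide)

/-- Let `S` be generated by six elements as a module over a discrete valuation ring `O` with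
residue field `𝔽₃` and let it contain primitive fourth and seventh roots of unity. As `𝔽₃` needs
an extension of degree six to contain these, `S/ϖS` is a field. -/
theorem isUnit_of_not_dvd_of_roots_of_unity {O : Type u} {S : Type v} [CommRing O] [IsDomain O]
    [IsDiscreteValuationRing O] [CommRing S] [Algebra O S] {ϖ : O} (hϖ : Irreducible ϖ)
    (h3 : ϖ ∣ 3) (hres : ∀ x : O, ∃ n : Fin 3, ϖ ∣ x - (n : ℕ)) {i g : S} (hi : i * i = -1)
    (hg : ∑ j ∈ Finset.range 7, g ^ j = 0) (b : Fin 6 → S)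
    (hb : Submodule.span O (Set.range b) = ⊤) {x : S} (hx : ¬ algebraMap O S ϖ ∣ x) : IsUnit x := by
  by_contra hu
  obtain ⟨M, hM, hxM⟩ := exists_max_ideal_of_mem_nonunits hu
  have : Module.Finite O S := ⟨hb ▸ Submodule.fg_span (Set.finite_range b)⟩
  have hϖM : algebraMap O S ϖ ∈ M := by
    have hmax := Ideal.isMaximal_comap_of_isIntegral_of_isMaximal (R := O) M
    have hmem : ϖ ∈ IsLocalRing.maximalIdeal O := (IsLocalRing.mem_maximalIdeal _).2 hϖ.not_isUnit
    rw [← IsLocalRing.eq_maximalIdeal hmax] at hmem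
    exact hmem
  set I : Ideal S := Ideal.span {algebraMap O S ϖ} with hI
  have hIM : I ≤ M := (Ideal.span_singleton_le_iff_mem M).2 hϖM
  -- representatives of `S / ϖ S`
  let r : (Fin 6 → Fin 3) → S ⧸ I := fun n ↦ ∑ j, Ideal.Quotient.mk I (((n j : ℕ) : S) * b j)
  have hr : Function.Surjective r := by
    intro y
    obtain ⟨y, rfl⟩ := Ideal.Quotient.mk_surjective y
    have hy : y ∈ Submodule.span O (Set.range b) := hb ▸ trivial
    obtain ⟨c, rfl⟩ := (Submodule.mem_span_range_iff_exists_fun O).1 hy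
    choose n hn using hres
    refine ⟨fun j ↦ n (c j), ?_⟩
    rw [map_sum]
    refine Finset.sum_congr rfl fun j _ ↦ (Ideal.Quotient.eq.2 ?_).symm
    obtain ⟨e, he⟩ := hn (c j)
    rw [Ideal.mem_span_singleton]
    refine ⟨algebraMap O S e * b j, ?_⟩
    rw [Algebra.smul_def, ← sub_mul, ← map_natCast (algebraMap O S), ← map_sub, he, map_mul,
      mul_assoc]
  have : Finite (S ⧸ I) := Finite.of_surjective r hr
  have hcard : Nat.card (S ⧸ I) ≤ 3 ^ 6 := by
    simpa using Nat.card_le_card_of_surjective r hr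
  have hsurj := Ideal.Quotient.factor_surjective hIM
  have : Finite (S ⧸ M) := Finite.of_surjective _ hsurj
  let _ : Field (S ⧸ M) := Ideal.Quotient.field M
  have h30 : (3 : S ⧸ M) = 0 := by
    obtain ⟨e, he⟩ := h3
    have h : Ideal.Quotient.mk M (algebraMap O S 3) = 0 := by
      rw [Ideal.Quotient.eq_zero_iff_mem, he, map_mul]
      exact Ideal.mul_mem_right _ _ hϖM
    rwa [map_ofNat, map_ofNat] at h
  have hM729 : Nat.card (S ⧸ M) = 3 ^ 6 := by
    refine card_eq_of_charP_three h30 (i := Ideal.Quotient.mk M i) (g := Ideal.Quotient.mk M g)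
      (by rw [← map_mul, hi, map_neg, map_one]) ?_
      ((Nat.card_le_card_of_surjective _ hsurj).trans hcard)
    simpa using congrArg (Ideal.Quotient.mk M) hg
  have hinj : Function.Injective (Ideal.Quotient.factor hIM) :=
    ((Nat.bijective_iff_surjective_and_card _).2
      ⟨hsurj, le_antisymm (hcard.trans hM729.ge) (Nat.card_le_card_of_surjective _ hsurj)⟩).1
  apply hx
  rw [← Ideal.mem_span_singleton, ← hI, ← Ideal.Quotient.eq_zero_iff_mem]
  apply hinj
  rw [map_zero, Ideal.Quotient.factor_mk, Ideal.Quotient.eq_zero_iff_mem]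
  exact hxM

/-- Generators `i`, `g` of an unramified extension of degree six of a discrete valuation ring `O`
with residue field `𝔽₃` and uniformizer `ϖ`, inside an `O`-algebra `A`: a central square root `i` of
`-1`, and a primitive seventh root of unity `g` whose period `g + g² + g⁴` lies in `O[i]`. -/
structure IsSexticDatum {O : Type u} {A : Type w} [CommRing O] [Ring A] [Algebra O A]
    (ϖ : O) (i g : A) : Prop where
  irreducible : Irreducible ϖ
  dvd_three : ϖ ∣ 3
  residue : ∀ x : O, ∃ n : Fin 3, ϖ ∣ x - (n : ℕ)
  central : ∀ a : A, i * a = a * i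
  sq : i * i = -1
  sum : ∑ j ∈ Finset.range 7, g ^ j = 0
  period : ∃ c d : O, g + g ^ 2 + g ^ 4 = algebraMap O A c + algebraMap O A d * i

/-- The ring `O[i, g]`. -/
abbrev sexticOrder (O : Type u) {A : Type w} [CommRing O] [Ring A] [Algebra O A] (i g : A) :
    Subalgebra O A :=
  Algebra.adjoin O {i, g}

/-- The units of a subring, as elements of the ambient ring. -/
def IsUnitIn {O : Type u} {A : Type w} [CommRing O] [Ring A] [Algebra O A] (S : Subalgebra O A)
    (e : A) : Prop :=
  e ∈ S ∧ ∃ e' ∈ S, e * e' = 1 ∧ e' * e = 1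

theorem IsUnitIn.mul {O : Type u} {A : Type w} [CommRing O] [Ring A] [Algebra O A]
    {S : Subalgebra O A} {e f : A} (he : IsUnitIn S e) (hf : IsUnitIn S f) : IsUnitIn S (e * f) := by
  obtain ⟨he, e', he', h1, h2⟩ := he
  obtain ⟨hf, f', hf', h3, h4⟩ := hf
  refine ⟨mul_mem he hf, f' * e', mul_mem hf' he', ?_, ?_⟩
  · rw [mul_assoc, ← mul_assoc f, h3, one_mul, h1]
  · rw [mul_assoc, ← mul_assoc e', h2, one_mul, h4]

theorem pow_seven_eq_one_of_sum {A : Type w} [Ring A] {g : A}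
    (h : ∑ j ∈ Finset.range 7, g ^ j = 0) : g ^ 7 = 1 := by
  rw [← sub_eq_zero, ← geom_sum_mul, h, zero_mul]

/-- `g` is a root of `(X - g) (X - g²) (X - g⁴) = X³ - η X² - (η + 1) X - 1`, where
`η = g + g² + g⁴`. -/
theorem pow_three_eq_of_sum {A : Type w} [Ring A] {g : A}
    (h : ∑ j ∈ Finset.range 7, g ^ j = 0) :
    g ^ 3 = (g + g ^ 2 + g ^ 4) * g ^ 2 + (g + g ^ 2 + g ^ 4 + 1) * g + 1 := by
  simp only [Finset.sum_range_succ, Finset.sum_range_zero, zero_add, pow_zero, pow_one] at h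
  have h2 : (g + g ^ 2 + g ^ 4) * g ^ 2 + (g + g ^ 2 + g ^ 4 + 1) * g + 1 - g ^ 3
      = 1 + g + g ^ 2 + g ^ 3 + g ^ 4 + g ^ 5 + g ^ 6 := by
    noncomm_ring
  rw [h, sub_eq_zero] at h2
  exact h2.symm

namespace IsSexticDatum

section Order

variable {O : Type u} {A : Type w} [CommRing O] [Ring A] [Algebra O A] {ϖ : O} {i g : A}

theorem left_mem : i ∈ sexticOrder O i g := Algebra.subset_adjoin (by simp)

theorem right_mem : g ∈ sexticOrder O i g := Algebra.subset_adjoin (by simp)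

theorem commute_of_mem (h : IsSexticDatum ϖ i g) {x y : A} (hx : x ∈ sexticOrder O i g)
    (hy : y ∈ sexticOrder O i g) : x * y = y * x := by
  have hcomm : ∀ a ∈ ({i, g} : Set A), ∀ b ∈ ({i, g} : Set A), a * b = b * a := by
    rintro a (rfl | rfl) b (rfl | rfl)
    · rfl
    · exact h.central _
    · exact (h.central _).symm
    · rfl
  have : IsMulCommutative (sexticOrder O i g) := Algebra.isMulCommutative_adjoin O hcomm
  exact congrArg Subtype.val (mul_comm' (⟨x, hx⟩ : sexticOrder O i g) ⟨y, hy⟩)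

theorem toSubmodule_eq_span (h : IsSexticDatum ϖ i g) :
    Subalgebra.toSubmodule (sexticOrder O i g) =
      Submodule.span O (Set.range ![1, g, g ^ 2, i, i * g, i * g ^ 2]) := by
  set b : Fin 6 → A := ![1, g, g ^ 2, i, i * g, i * g ^ 2] with hb
  set W := Submodule.span O (Set.range b) with hW
  have hmem (j : Fin 6) : b j ∈ W := Submodule.subset_span ⟨j, rfl⟩
  have m0 : (1 : A) ∈ W := hmem 0
  have m1 : g ∈ W := hmem 1
  have m2 : g ^ 2 ∈ W := hmem 2
  have m3 : i ∈ W := hmem 3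
  have m4 : i * g ∈ W := hmem 4
  have m5 : i * g ^ 2 ∈ W := hmem 5
  have hi : ∀ x ∈ W, i * x ∈ W := by
    intro x hx
    induction hx using Submodule.span_induction with
    | zero => simp
    | add x y _ _ hx hy => rw [mul_add]; exact add_mem hx hy
    | smul c x _ hx => rw [mul_smul_comm]; exact W.smul_mem c hx
    | mem x hx =>
      obtain ⟨j, rfl⟩ := hx
      have hsq (a : A) : i * (i * a) = -a := by rw [← mul_assoc, h.sq, neg_one_mul]
      fin_cases j
      · change i * 1 ∈ W
        rwa [mul_one]
      · exact m4
      · exact m5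
      · change i * i ∈ W
        rw [h.sq]; exact neg_mem m0
      · change i * (i * g) ∈ W
        rw [hsq]; exact neg_mem m1
      · change i * (i * g ^ 2) ∈ W
        rw [hsq]; exact neg_mem m2
  have hη : ∀ x ∈ W, (g + g ^ 2 + g ^ 4) * x ∈ W := by
    intro x hx
    obtain ⟨c, d, hcd⟩ := h.period
    rw [hcd, add_mul, mul_assoc, ← Algebra.smul_def, ← Algebra.smul_def]
    exact add_mem (W.smul_mem c hx) (W.smul_mem d (hi x hx))
  have m6 : g ^ 3 ∈ W := by
    rw [pow_three_eq_of_sum h.sum, add_mul _ 1 g, one_mul]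
    exact add_mem (add_mem (hη _ m2) (add_mem (hη _ m1) m1)) m0
  have hg : ∀ x ∈ W, g * x ∈ W := by
    intro x hx
    induction hx using Submodule.span_induction with
    | zero => simp
    | add x y _ _ hx hy => rw [mul_add]; exact add_mem hx hy
    | smul c x _ hx => rw [mul_smul_comm]; exact W.smul_mem c hx
    | mem x hx =>
      obtain ⟨j, rfl⟩ := hx
      fin_cases j
      · change g * 1 ∈ W
        rwa [mul_one]
      · change g * g ∈ W
        rwa [← pow_two]
      · change g * g ^ 2 ∈ W
        rwa [← pow_succ']
      · change g * i ∈ W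
        rwa [← h.central]
      · change g * (i * g) ∈ W
        rw [← mul_assoc, ← h.central, mul_assoc, ← pow_two]
        exact m5
      · change g * (i * g ^ 2) ∈ W
        rw [← mul_assoc, ← h.central, mul_assoc, ← pow_succ']
        exact hi _ m6
  apply le_antisymm
  · intro x hx
    have key : ∀ y ∈ W, x * y ∈ W := by
      change x ∈ sexticOrder O i g at hx
      induction hx using Algebra.adjoin_induction with
      | mem x hx =>
        rcases hx with rfl | rfl
        · exact hi
        · exact hg
      | algebraMap r => exact fun y hy ↦ by rw [← Algebra.smul_def]; exact W.smul_mem r hy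
      | add x y _ _ hx hy => exact fun z hz ↦ by rw [add_mul]; exact add_mem (hx z hz) (hy z hz)
      | mul x y _ _ hx hy => exact fun z hz ↦ by rw [mul_assoc]; exact hx _ (hy z hz)
    simpa using key 1 m0
  · rw [hW, Submodule.span_le]
    rintro _ ⟨j, rfl⟩
    have hi := left_mem (O := O) (i := i) (g := g)
    have hg := right_mem (O := O) (i := i) (g := g)
    rw [SetLike.mem_coe, Subalgebra.mem_toSubmodule]
    fin_cases j
    · exact one_mem (sexticOrder O i g)
    · exact hg
    · exact pow_mem hg 2
    · exact hi
    · exact mul_mem hi hg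
    · exact mul_mem hi (pow_mem hg 2)

theorem fg_sexticOrder (h : IsSexticDatum ϖ i g) :
    (Subalgebra.toSubmodule (sexticOrder O i g)).FG :=
  h.toSubmodule_eq_span ▸ Submodule.fg_span (Set.finite_range _)

/-- The ring `O[i, g]` is local with maximal ideal generated by `ϖ`. -/
theorem isUnitIn_or_exists [IsDomain O] [IsDiscreteValuationRing O] (h : IsSexticDatum ϖ i g)
    {x : A} (hx : x ∈ sexticOrder O i g) :
    IsUnitIn (sexticOrder O i g) x ∨ ∃ y ∈ sexticOrder O i g, x = ϖ • y := by
  set S := sexticOrder O i g with hS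
  let _ : CommRing S := { (inferInstance : Ring S) with
    mul_comm := fun a b ↦ Subtype.ext (h.commute_of_mem a.2 b.2) }
  by_cases hd : algebraMap O S ϖ ∣ ⟨x, hx⟩
  · right
    obtain ⟨y, hy⟩ := hd
    exact ⟨y, y.2, by rw [Algebra.smul_def]; exact congrArg Subtype.val hy⟩
  · left
    have hmem (j : Fin 6) :
        (![1, g, g ^ 2, i, i * g, i * g ^ 2] : Fin 6 → A) j ∈ S := by
      rw [← Subalgebra.mem_toSubmodule, hS, h.toSubmodule_eq_span]
      exact Submodule.subset_span ⟨j, rfl⟩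
    let b : Fin 6 → S := fun j ↦ ⟨_, hmem j⟩
    have hb : Submodule.span O (Set.range b) = ⊤ := by
      apply Submodule.map_injective_of_injective
        (f := (Subalgebra.toSubmodule S).subtype) Subtype.val_injective
      rw [Submodule.map_span, ← Set.range_comp, Submodule.map_top, Submodule.range_subtype]
      exact h.toSubmodule_eq_span.symm
    obtain ⟨e, he⟩ := isUnit_of_not_dvd_of_roots_of_unity h.irreducible h.dvd_three h.residue
      (i := (⟨i, left_mem⟩ : S)) (g := (⟨g, right_mem⟩ : S)) (Subtype.ext h.sq)
      (Subtype.ext (by simpa using h.sum)) b hb hd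
    refine ⟨hx, (e⁻¹ : Sˣ).val, Subtype.prop _, ?_, ?_⟩
    · have := congrArg Subtype.val (Units.mul_inv e)
      rwa [he] at this
    · have := congrArg Subtype.val (Units.inv_mul e)
      rwa [he] at this

end Order

end IsSexticDatum

/-! ### Eigenspaces of conjugation by an element of order seven -/

section Eigen

variable {A : Type w} [Ring A] {g : A}

/-- Seven times the projection of `t` to the space of the `a` with `a g = gᵐ a`; note that
`g⁶ = g⁻¹`. -/
def eigenComponent (g : A) (m : ℕ) (t : A) : A :=
  ∑ j ∈ Finset.range 7, g ^ (6 * m * j) * t * g ^ j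

theorem geom_sum_pow_eq_zero (hg : ∑ j ∈ Finset.range 7, g ^ j = 0) {e : ℕ} (he : ¬ 7 ∣ e) :
    ∑ j ∈ Finset.range 7, (g ^ e) ^ j = 0 := by
  have h7 := pow_seven_eq_one_of_sum hg
  have h (j : ℕ) : (g ^ e) ^ j = g ^ (e % 7 * j % 7) := by
    rw [← pow_mul, pow_eq_pow_mod _ h7]
    congr 1
    exact ((Nat.mod_modEq e 7).mul_right j).symm
  simp only [h]
  have hlt : e % 7 < 7 := Nat.mod_lt _ (by norm_num)
  have hne : e % 7 ≠ 0 := fun h ↦ he (Nat.dvd_of_mod_eq_zero h)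
  generalize e % 7 = r at hlt hne ⊢
  rw [← hg]
  have hpos : 1 ≤ r := Nat.pos_of_ne_zero hne
  interval_cases r
  all_goals
    simp only [Finset.sum_range_succ, Finset.sum_range_zero, Nat.reduceMul, Nat.reduceMod] <;> abel

theorem geom_sum_pow_eq_seven (h7 : g ^ 7 = 1) {e : ℕ} (he : 7 ∣ e) :
    ∑ j ∈ Finset.range 7, (g ^ e) ^ j = 7 := by
  obtain ⟨q, rfl⟩ := he
  simp [pow_mul, h7]

theorem pow_mul_eq_of_eigen {a : A} {m : ℕ} (ha : a * g = g ^ m * a) (j : ℕ) :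
    a * g ^ j = g ^ (m * j) * a := by
  induction j with
  | zero => simp
  | succ j ih => rw [pow_succ, ← mul_assoc, ih, mul_assoc, ha, ← mul_assoc, ← pow_add, mul_add_one]

theorem eigenComponent_mul (h7 : g ^ 7 = 1) (m : ℕ) (t : A) :
    eigenComponent g m t * g = g ^ m * eigenComponent g m t := by
  have hterm (j : ℕ) :
      g ^ m * (g ^ (6 * m * (j + 1)) * t * g ^ (j + 1)) = g ^ (6 * m * j) * t * g ^ j * g := by
    have : g ^ m * g ^ (6 * m * (j + 1)) = g ^ (6 * m * j) := by
      rw [← pow_add, show m + 6 * m * (j + 1) = 7 * m + 6 * m * j by ring, pow_add, pow_mul, h7,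
        one_pow, one_mul]
    rw [← mul_assoc, ← mul_assoc, this, pow_succ, ← mul_assoc]
  have h0 : g ^ m * (g ^ (6 * m * 0) * t * g ^ 0) = g ^ (6 * m * 6) * t * g ^ 6 * g := by
    have : g ^ (6 * m * 6) = g ^ m := by
      rw [show 6 * m * 6 = 7 * (5 * m) + m by ring, pow_add, pow_mul, h7, one_pow, one_mul]
    rw [this, mul_assoc _ (g ^ 6), ← pow_succ, h7]
    simp
  rw [eigenComponent, Finset.sum_mul, Finset.mul_sum]
  conv_lhs => rw [Finset.sum_range_succ]
  conv_rhs => rw [Finset.sum_range_succ', h0]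
  simp only [hterm]

theorem sum_eigenComponent (hg : ∑ j ∈ Finset.range 7, g ^ j = 0) (t : A) :
    ∑ m ∈ Finset.range 7, eigenComponent g m t = 7 * t := by
  have h7 := pow_seven_eq_one_of_sum hg
  unfold eigenComponent
  rw [Finset.sum_comm]
  have h (j : ℕ) : ∑ m ∈ Finset.range 7, g ^ (6 * m * j) * t * g ^ j =
      (∑ m ∈ Finset.range 7, (g ^ (6 * j)) ^ m) * t * g ^ j := by
    rw [Finset.sum_mul, Finset.sum_mul]
    refine Finset.sum_congr rfl fun m _ ↦ ?_
    rw [← pow_mul, mul_right_comm 6 m j]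
  simp only [h]
  rw [Finset.sum_eq_single 0]
  · rw [geom_sum_pow_eq_seven h7 (by simp)]; simp
  · intro j hj hj0
    rw [geom_sum_pow_eq_zero hg, zero_mul, zero_mul]
    have := Finset.mem_range.1 hj
    omega
  · simp

theorem eigenComponent_of_eigen {t : A} {m m' : ℕ} (ht : t * g = g ^ m' * t) :
    eigenComponent g m t = (∑ j ∈ Finset.range 7, (g ^ (6 * m + m')) ^ j) * t := by
  rw [eigenComponent, Finset.sum_mul]
  refine Finset.sum_congr rfl fun j _ ↦ ?_
  rw [mul_assoc, pow_mul_eq_of_eigen ht, ← mul_assoc, ← pow_add, ← pow_mul, add_mul]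

theorem eigenComponent_add (m : ℕ) (s t : A) :
    eigenComponent g m (s + t) = eigenComponent g m s + eigenComponent g m t := by
  simp only [eigenComponent, mul_add, add_mul, Finset.sum_add_distrib]

theorem eigenComponent_self (hg : ∑ j ∈ Finset.range 7, g ^ j = 0) {t : A} {m m' : ℕ}
    (ht : t * g = g ^ m' * t) (hm : 7 ∣ 6 * m + m') : eigenComponent g m t = 7 * t := by
  rw [eigenComponent_of_eigen ht, geom_sum_pow_eq_seven (pow_seven_eq_one_of_sum hg) hm]

theorem eigenComponent_eq_zero (hg : ∑ j ∈ Finset.range 7, g ^ j = 0) {t : A} {m m' : ℕ}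
    (ht : t * g = g ^ m' * t) (hm : ¬ 7 ∣ 6 * m + m') : eigenComponent g m t = 0 := by
  rw [eigenComponent_of_eigen ht, geom_sum_pow_eq_zero hg hm, zero_mul]

end Eigen

/-! ### The valuation on the unramified extension of degree six -/

/-- `f` is the product of `ϖⁿ` and a unit of `O[i, g]`. -/
def HasOrder {O : Type u} (K : Type v) {A : Type w} [CommRing O] [Field K] [Algebra O K] [Ring A]
    [Algebra O A] [Algebra K A] (ϖ : O) (i g : A) (n : ℤ) (f : A) : Prop :=
  ∃ e, IsUnitIn (sexticOrder O i g) e ∧ f = (algebraMap O K ϖ ^ n) • e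

section HasOrder

variable {O : Type u} {K : Type v} {A : Type w} [CommRing O] [IsDomain O] [IsDiscreteValuationRing O]
  [Field K] [Algebra O K] [IsFractionRing O K] [Ring A] [Nontrivial A] [Algebra O A] [Algebra K A]
  [IsScalarTower O K A] {ϖ : O} {i g : A}

/-- No element of a lattice order is of the form `ϖⁿ` with `n < 0`. -/
theorem nonneg_of_zpow_mem (hϖ : Irreducible ϖ) {T : Subalgebra O A}
    (hT : (Subalgebra.toSubmodule T).FG) {n : ℤ}
    (h : (algebraMap O K ϖ ^ n) • (1 : A) ∈ T) : 0 ≤ n := by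
  by_contra hn
  have hint := IsIntegral.of_mem_of_fg T hT _ h
  rw [← Algebra.algebraMap_eq_smul_one,
    isIntegral_algebraMap_iff (algebraMap K A).injective,
    IsIntegrallyClosed.isIntegral_iff] at hint
  obtain ⟨y, hy⟩ := hint
  have hϖ0 : algebraMap O K ϖ ≠ 0 := by
    rw [Ne, FaithfulSMul.algebraMap_eq_zero_iff]
    exact hϖ.ne_zero
  obtain ⟨m, hm⟩ : ∃ m : ℕ, n = -(m + 1 : ℕ) := ⟨(-n - 1).toNat, by omega⟩
  rw [hm, zpow_neg, zpow_natCast] at hy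
  have h1 : y * ϖ ^ (m + 1) = 1 := by
    apply FaithfulSMul.algebraMap_injective O K
    rw [map_mul, hy, map_pow, map_one, inv_mul_cancel₀ (pow_ne_zero _ hϖ0)]
  exact hϖ.not_isUnit (IsUnit.of_mul_eq_one (y * ϖ ^ m) (by rw [← h1]; ring))

namespace IsSexticDatum

omit [IsDomain O] [IsDiscreteValuationRing O] [Nontrivial A] [Algebra K A] [IsScalarTower O K A] in
theorem algebraMap_ne_zero (h : IsSexticDatum ϖ i g) : algebraMap O K ϖ ≠ 0 := by
  rw [Ne, FaithfulSMul.algebraMap_eq_zero_iff]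
  exact h.irreducible.ne_zero

omit [IsDomain O] [IsDiscreteValuationRing O] [Nontrivial A] [IsScalarTower O K A] in
theorem hasOrder_mul (h : IsSexticDatum ϖ i g) {m n : ℤ} {x y : A} (hx : HasOrder K ϖ i g m x)
    (hy : HasOrder K ϖ i g n y) : HasOrder K ϖ i g (m + n) (x * y) := by
  obtain ⟨e, he, rfl⟩ := hx
  obtain ⟨f, hf, rfl⟩ := hy
  exact ⟨e * f, he.mul hf, by
    rw [smul_mul_smul_comm, zpow_add₀ (h.algebraMap_ne_zero (K := K))]⟩

theorem nonneg_of_hasOrder_of_mem (h : IsSexticDatum ϖ i g) {T : Subalgebra O A}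
    (hT : (Subalgebra.toSubmodule T).FG) (hle : sexticOrder O i g ≤ T) {n : ℤ} {x : A}
    (hx : HasOrder K ϖ i g n x) (hxT : x ∈ T) : 0 ≤ n := by
  obtain ⟨e, ⟨-, e', he', hee', -⟩, rfl⟩ := hx
  apply nonneg_of_zpow_mem (K := K) h.irreducible hT
  rw [← hee', ← smul_mul_assoc]
  exact mul_mem hxT (hle he')

omit [IsDomain O] [IsDiscreteValuationRing O] [IsFractionRing O K] [Nontrivial A] in
theorem mem_of_hasOrder_of_nonneg {n : ℤ} (hn : 0 ≤ n) {x : A}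
    (hx : HasOrder K ϖ i g n x) : x ∈ sexticOrder O i g := by
  obtain ⟨e, ⟨he, -⟩, rfl⟩ := hx
  lift n to ℕ using hn
  rw [zpow_natCast, ← map_pow, algebraMap_smul]
  exact Subalgebra.smul_mem _ he _

omit [Nontrivial A] in
theorem exists_pow_smul_mem (h : IsSexticDatum ϖ i g) {f : A} (hf : f ∈ Algebra.adjoin K {i, g}) :
    ∃ n : ℕ, (ϖ ^ n) • f ∈ sexticOrder O i g := by
  induction hf using Algebra.adjoin_induction with
  | mem x hx => exact ⟨0, by simpa using Algebra.subset_adjoin hx⟩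
  | algebraMap c =>
    obtain ⟨a, b, hb, rfl⟩ := IsFractionRing.div_surjective (A := O) c
    obtain ⟨n, u, hu⟩ := IsDiscreteValuationRing.eq_unit_mul_pow_irreducible
      (nonZeroDivisors.ne_zero hb) h.irreducible
    refine ⟨n, ?_⟩
    have hb0 : algebraMap O K b ≠ 0 := by
      rw [Ne, FaithfulSMul.algebraMap_eq_zero_iff]; exact nonZeroDivisors.ne_zero hb
    have : ϖ ^ n • (algebraMap O K a / algebraMap O K b) = algebraMap O K ((u⁻¹ : Oˣ) * a) := by
      rw [Algebra.smul_def, ← mul_div_assoc, div_eq_iff hb0, ← map_mul, ← map_mul, hu]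
      congr 1
      linear_combination -(ϖ ^ n * a) * u.inv_mul
    rw [Algebra.algebraMap_eq_smul_one, ← smul_assoc, this, algebraMap_smul,
      ← Algebra.algebraMap_eq_smul_one]
    exact Subalgebra.algebraMap_mem _ _
  | add x y _ _ hx hy =>
    obtain ⟨m, hm⟩ := hx
    obtain ⟨n, hn⟩ := hy
    refine ⟨m + n, ?_⟩
    rw [smul_add]
    refine add_mem ?_ ?_
    · rw [add_comm, pow_add, mul_smul]
      exact Subalgebra.smul_mem _ hm _
    · rw [pow_add, mul_smul]
      exact Subalgebra.smul_mem _ hn _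
  | mul x y _ _ hx hy =>
    obtain ⟨m, hm⟩ := hx
    obtain ⟨n, hn⟩ := hy
    exact ⟨m + n, by rw [pow_add, ← smul_mul_smul_comm]; exact mul_mem hm hn⟩

/-- The nonzero elements of `K[i, g]` are products of powers of `ϖ` and units of `O[i, g]`. -/
theorem exists_hasOrder (h : IsSexticDatum ϖ i g) {f : A} (hf : f ∈ Algebra.adjoin K {i, g})
    (hf0 : f ≠ 0) : ∃ n : ℤ, HasOrder K ϖ i g n f := by
  obtain ⟨N, hN⟩ := h.exists_pow_smul_mem hf
  have hK := h.algebraMap_ne_zero (K := K)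
  set S := sexticOrder O i g
  have : Module.Finite O S := .of_fg h.fg_sexticOrder
  -- the element `ϖᴺ f` of `S` is divisible by only finitely many powers of `ϖ`
  have hex : ∃ n : ℕ, ¬ ∃ y ∈ S, (ϖ ^ N) • f = (ϖ ^ n) • y := by
    by_contra! hall
    have hmem : (⟨ϖ ^ N • f, hN⟩ : S) ∈ (⨅ n : ℕ, IsLocalRing.maximalIdeal O ^ n • ⊤ : Submodule O S) := by
      rw [Submodule.mem_iInf]
      intro n
      obtain ⟨y, hy, hyf⟩ := hall n
      have : (⟨ϖ ^ N • f, hN⟩ : S) = ϖ ^ n • (⟨y, hy⟩ : S) := Subtype.ext hyf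
      rw [this]
      exact Submodule.smul_mem_smul (Ideal.pow_mem_pow
        ((IsLocalRing.mem_maximalIdeal _).2 h.irreducible.not_isUnit) n) trivial
    rw [Ideal.iInf_pow_smul_eq_bot_of_isLocalRing _ (IsLocalRing.maximalIdeal.isMaximal O).ne_top,
      Submodule.mem_bot, Subtype.ext_iff] at hmem
    have h0 : (algebraMap O K ϖ) ^ N • f = 0 := by
      rw [← map_pow, algebraMap_smul]; exact hmem
    exact (smul_ne_zero (pow_ne_zero N hK) hf0) h0
  classical
  have hspec := Nat.find_spec hex
  obtain ⟨n, hn⟩ : ∃ n, Nat.find hex = n + 1 := by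
    refine Nat.exists_eq_succ_of_ne_zero fun h0 ↦ hspec ⟨ϖ ^ N • f, hN, by rw [h0]; simp⟩
  obtain ⟨y, hy, hyf⟩ := not_not.1 (Nat.find_min hex (m := n) (by omega))
  refine ⟨n - N, y, ?_, ?_⟩
  · refine (h.isUnitIn_or_exists hy).resolve_right ?_
    rintro ⟨z, hz, rfl⟩
    rw [hn] at hspec
    exact hspec ⟨z, hz, by rw [hyf, smul_smul, pow_succ]⟩
  · rw [← algebraMap_smul K, ← algebraMap_smul K (ϖ ^ n), map_pow, map_pow] at hyf
    rw [zpow_sub₀ hK, zpow_natCast, zpow_natCast, div_eq_inv_mul, mul_smul, ← hyf,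
      inv_smul_smul₀ (pow_ne_zero N hK)]

end IsSexticDatum

end HasOrder

/-! ### Orders in a cyclic algebra of degree three -/

/-- The algebra `A` is a cyclic algebra `F ⊕ F u ⊕ F u²` over `F = K[i, g]`, where conjugation by `u`
raises `g` to the power `r = 2` or `r = 4`. -/
structure IsCyclicDatum {O : Type u} (K : Type v) {A : Type w} [CommRing O] [Field K] [Algebra O K]
    [Ring A] [Algebra O A] [Algebra K A] (ϖ : O) (i g : A) (r : ℕ) (u : Aˣ) : Prop where
  sextic : IsSexticDatum ϖ i g
  exponent : r = 2 ∨ r = 4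
  conj : u * g = g ^ r * u
  decomp : ∀ a : A, ∃ f₀ ∈ Algebra.adjoin K {i, g}, ∃ f₁ ∈ Algebra.adjoin K {i, g},
    ∃ f₂ ∈ Algebra.adjoin K {i, g}, a = f₀ + f₁ * u + f₂ * u ^ 2

section Cyclic

variable {O : Type u} {K : Type v} {A : Type w} [CommRing O] [IsDomain O] [IsDiscreteValuationRing O]
  [Field K] [Algebra O K] [IsFractionRing O K] [Ring A] [Nontrivial A] [Algebra O A] [Algebra K A]
  [IsScalarTower O K A] {ϖ : O} {i g : A} {r : ℕ} {u : Aˣ}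

namespace IsSexticDatum

omit [IsDomain O] [IsDiscreteValuationRing O] [Nontrivial A] [Algebra K A] [IsScalarTower O K A]
  [Field K] [Algebra O K] [IsFractionRing O K] in
theorem conj_mem (h : IsSexticDatum ϖ i g) {w : Aˣ} {m : ℕ} (hw : w * g = g ^ m * w) {x : A}
    (hx : x ∈ sexticOrder O i g) : w * x * (w⁻¹ : Aˣ) ∈ sexticOrder O i g := by
  induction hx using Algebra.adjoin_induction with
  | mem x hx =>
    rcases hx with rfl | rfl
    · rw [← h.central, mul_assoc, Units.mul_inv, mul_one]; exact left_mem
    · rw [hw, mul_assoc, Units.mul_inv, mul_one]; exact pow_mem right_mem _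
  | algebraMap c =>
    rw [← Algebra.commutes, mul_assoc, Units.mul_inv, mul_one]
    exact Subalgebra.algebraMap_mem _ c
  | add x y _ _ hx hy => rw [mul_add, add_mul]; exact add_mem hx hy
  | mul x y _ _ hx hy =>
    have : w * (x * y) * (w⁻¹ : Aˣ) = (w * x * (w⁻¹ : Aˣ)) * (w * y * (w⁻¹ : Aˣ)) := by
      simp only [mul_assoc, Units.inv_mul_cancel_left]
    rw [this]; exact mul_mem hx hy

omit [IsDomain O] [IsDiscreteValuationRing O] [Nontrivial A] [IsScalarTower O K A]
  [IsFractionRing O K] in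
theorem hasOrder_conj (h : IsSexticDatum ϖ i g) {w : Aˣ} {m : ℕ} (hw : w * g = g ^ m * w) {n : ℤ}
    {x : A} (hx : HasOrder K ϖ i g n x) : HasOrder K ϖ i g n (w * x * (w⁻¹ : Aˣ)) := by
  obtain ⟨e, ⟨he, e', he', h1, h2⟩, rfl⟩ := hx
  refine ⟨w * e * (w⁻¹ : Aˣ), ⟨h.conj_mem hw he, w * e' * (w⁻¹ : Aˣ), h.conj_mem hw he', ?_, ?_⟩, ?_⟩
  · simp only [mul_assoc, Units.inv_mul_cancel_left]
    rw [← mul_assoc e, h1, one_mul, Units.mul_inv]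
  · simp only [mul_assoc, Units.inv_mul_cancel_left]
    rw [← mul_assoc e', h2, one_mul, Units.mul_inv]
  · rw [mul_smul_comm, smul_mul_assoc]

/-- If `w³` has order at most two, then `f w` can only be integral if `f` is: the order of
`(f w)³` is three times that of `f` plus that of `w³`. -/
theorem mem_of_pow_three_mem (h : IsSexticDatum ϖ i g) {w : Aˣ} {m : ℕ} (hw : w * g = g ^ m * w)
    {b : ℤ} (hwb : HasOrder K ϖ i g b ((w : A) ^ 3)) (hb : b ≤ 2) {T : Subalgebra O A}
    (hT : (Subalgebra.toSubmodule T).FG) (hle : sexticOrder O i g ≤ T) {f : A}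
    (hf : f ∈ Algebra.adjoin K {i, g}) (hfT : (f * w) ^ 3 ∈ T) : f ∈ sexticOrder O i g := by
  by_cases hf0 : f = 0
  · rw [hf0]; exact zero_mem _
  obtain ⟨n, hn⟩ := h.exists_hasOrder hf hf0
  have h1 := h.hasOrder_conj hw hn
  have h2 := h.hasOrder_conj hw h1
  have key : (f * w) ^ 3 = f * (w * f * (w⁻¹ : Aˣ)) *
      (w * (w * f * (w⁻¹ : Aˣ)) * (w⁻¹ : Aˣ)) * (w : A) ^ 3 := by
    simp only [pow_succ, pow_zero, one_mul, mul_assoc, Units.inv_mul_cancel_left]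
  have h3 := h.hasOrder_mul (h.hasOrder_mul (h.hasOrder_mul hn h1) h2) hwb
  rw [← key] at h3
  have := h.nonneg_of_hasOrder_of_mem hT hle h3 hfT
  exact mem_of_hasOrder_of_nonneg (K := K) (by omega) hn

omit [IsDomain O] [IsDiscreteValuationRing O] [IsFractionRing O K] [Nontrivial A]
  [IsScalarTower O K A] [Algebra O K] in
theorem mul_right_generator_comm (h : IsSexticDatum ϖ i g) {f : A} (hf : f ∈ Algebra.adjoin K {i, g}) :
    f * g = g * f := by
  induction hf using Algebra.adjoin_induction with
  | mem x hx =>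
    rcases hx with rfl | rfl
    · exact h.central _
    · rfl
  | algebraMap c => exact Algebra.commutes c g
  | add x y _ _ hx hy => rw [mul_add, add_mul, hx, hy]
  | mul x y _ _ hx hy => rw [mul_assoc, hy, ← mul_assoc, hx, mul_assoc]

omit [Nontrivial A] in
theorem exists_mul_seven_eq_one (h : IsSexticDatum ϖ i g) : ∃ s : O, s * 7 = 1 := by
  obtain ⟨e, he⟩ := h.dvd_three
  refine IsUnit.exists_left_inv ?_
  by_contra hu
  have h7 : (7 : O) ∈ IsLocalRing.maximalIdeal O := hu
  have h3 : (3 : O) ∈ IsLocalRing.maximalIdeal O := by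
    rw [he]
    exact Ideal.mul_mem_right _ _ h.irreducible.not_isUnit
  refine (IsLocalRing.maximalIdeal.isMaximal O).ne_top ((Ideal.eq_top_iff_one _).2 ?_)
  have := sub_mem h7 (Ideal.mul_mem_left _ 2 h3)
  norm_num at this

end IsSexticDatum

namespace IsCyclicDatum

omit [IsDomain O] [IsDiscreteValuationRing O] [IsFractionRing O K] [Nontrivial A]
  [IsScalarTower O K A] in
theorem conj_sq (h : IsCyclicDatum K ϖ i g r u) : ((u ^ 2 : Aˣ) : A) * g = g ^ (r * r) * (u ^ 2 : Aˣ) := by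
  rw [Units.val_pow_eq_pow_val, pow_two, mul_assoc, h.conj, ← mul_assoc,
    pow_mul_eq_of_eigen h.conj, mul_assoc]

omit [IsDomain O] [IsDiscreteValuationRing O] [IsFractionRing O K] [Nontrivial A]
  [IsScalarTower O K A] in
/-- The components of `a = f₀ + f₁ u + f₂ u²`. -/
theorem eigenComponent_eq (h : IsCyclicDatum K ϖ i g r u) {f₀ f₁ f₂ : A}
    (h₀ : f₀ ∈ Algebra.adjoin K {i, g}) (h₁ : f₁ ∈ Algebra.adjoin K {i, g})
    (h₂ : f₂ ∈ Algebra.adjoin K {i, g}) :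
    eigenComponent g 1 (f₀ + f₁ * u + f₂ * u ^ 2) = 7 * f₀ ∧
    eigenComponent g r (f₀ + f₁ * u + f₂ * u ^ 2) = 7 * (f₁ * u) ∧
    eigenComponent g (r * r) (f₀ + f₁ * u + f₂ * u ^ 2) = 7 * (f₂ * u ^ 2) := by
  have e₀ : f₀ * g = g ^ 1 * f₀ := by rw [pow_one, h.sextic.mul_right_generator_comm h₀]
  have e₁ : f₁ * u * g = g ^ r * (f₁ * u) := by
    rw [mul_assoc, h.conj, ← mul_assoc, ← mul_assoc]
    congr 1
    exact ((show Commute f₁ g from h.sextic.mul_right_generator_comm h₁).pow_right r)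
  have e₂ : f₂ * u ^ 2 * g = g ^ (r * r) * (f₂ * u ^ 2) := by
    have := h.conj_sq
    rw [Units.val_pow_eq_pow_val] at this
    rw [mul_assoc, this, ← mul_assoc, ← mul_assoc]
    congr 1
    exact ((show Commute f₂ g from h.sextic.mul_right_generator_comm h₂).pow_right _)
  have hs := h.sextic.sum
  simp only [eigenComponent_add]
  rcases h.exponent with rfl | rfl
  all_goals
    refine ⟨?_, ?_, ?_⟩
    · rw [eigenComponent_self hs e₀ (by decide), eigenComponent_eq_zero hs e₁ (by decide),
        eigenComponent_eq_zero hs e₂ (by decide), add_zero, add_zero]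
    · rw [eigenComponent_eq_zero hs e₀ (by decide), eigenComponent_self hs e₁ (by decide),
        eigenComponent_eq_zero hs e₂ (by decide), add_zero, zero_add]
    · rw [eigenComponent_eq_zero hs e₀ (by decide), eigenComponent_eq_zero hs e₁ (by decide),
        eigenComponent_self hs e₂ (by decide), add_zero, zero_add]

omit [Nontrivial A] [IsFractionRing O K] [IsScalarTower O K A] in
theorem seven_mul_injective (h : IsCyclicDatum K ϖ i g r u) {x y : A} (hxy : 7 * x = 7 * y) : x = y := by
  obtain ⟨s, hs⟩ := h.sextic.exists_mul_seven_eq_one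
  have hs' : algebraMap O A s * 7 = 1 := by
    rw [← map_ofNat (algebraMap O A) 7, ← map_mul, hs, map_one]
  rw [← one_mul x, ← one_mul y, ← hs', mul_assoc, mul_assoc, hxy]

/-- Every order containing `O[i, g]` is contained in `O[i, g] + O[i, g] u + O[i, g] u²` if the order
of `u³` is `0` or `1`. -/
theorem exists_of_mem_order (h : IsCyclicDatum K ϖ i g r u) {b : ℤ}
    (hub : HasOrder K ϖ i g b ((u : A) ^ 3)) (hb0 : 0 ≤ b) (hb : b ≤ 1) {T : Subalgebra O A}
    (hT : (Subalgebra.toSubmodule T).FG) (hle : sexticOrder O i g ≤ T) {t : A} (ht : t ∈ T) :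
    ∃ f₀ ∈ sexticOrder O i g, ∃ f₁ ∈ sexticOrder O i g, ∃ f₂ ∈ sexticOrder O i g,
      t = f₀ + f₁ * u + f₂ * u ^ 2 := by
  obtain ⟨s, hs⟩ := h.sextic.exists_mul_seven_eq_one
  have hs' : algebraMap O A s * 7 = 1 := by
    rw [← map_ofNat (algebraMap O A) 7, ← map_mul, hs, map_one]
  have hgT : g ∈ T := hle IsSexticDatum.right_mem
  have hcomp (m : ℕ) : algebraMap O A s * eigenComponent g m t ∈ T :=
    mul_mem (Subalgebra.algebraMap_mem _ _)
      (sum_mem fun j _ ↦ mul_mem (mul_mem (pow_mem hgT _) ht) (pow_mem hgT _))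
  obtain ⟨f₀, h₀, f₁, h₁, f₂, h₂, rfl⟩ := h.decomp t
  obtain ⟨c₀, c₁, c₂⟩ := h.eigenComponent_eq h₀ h₁ h₂
  have m₀ := hcomp 1
  have m₁ := hcomp r
  have m₂ := hcomp (r * r)
  rw [c₀, ← mul_assoc, hs', one_mul] at m₀
  rw [c₁, ← mul_assoc, hs', one_mul] at m₁
  rw [c₂, ← mul_assoc, hs', one_mul] at m₂
  have hone : HasOrder K ϖ i g 0 (((1 : Aˣ) : A) ^ 3) :=
    ⟨1, ⟨one_mem _, 1, one_mem _, by simp, by simp⟩, by simp⟩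
  have hsq : HasOrder K ϖ i g (b + b) (((u ^ 2 : Aˣ) : A) ^ 3) := by
    have := h.sextic.hasOrder_mul hub hub
    rwa [← pow_add, show (u : A) ^ (3 + 3) = ((u ^ 2 : Aˣ) : A) ^ 3 by
      rw [Units.val_pow_eq_pow_val, ← pow_mul]] at this
  refine ⟨f₀, ?_, f₁, ?_, f₂, ?_, rfl⟩
  · exact h.sextic.mem_of_pow_three_mem (w := 1) (m := 1) (by simp) hone (by norm_num) hT hle h₀
      (pow_mem (by simpa using m₀) 3)
  · exact h.sextic.mem_of_pow_three_mem h.conj hub (by omega) hT hle h₁ (pow_mem m₁ 3)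
  · exact h.sextic.mem_of_pow_three_mem h.conj_sq hsq (by omega) hT hle h₂
      (pow_mem (by rwa [Units.val_pow_eq_pow_val]) 3)

omit [Nontrivial A] [IsDomain O] [IsDiscreteValuationRing O] [IsFractionRing O K]
  [IsScalarTower O K A] in
theorem exists_unit_mul_eq (h : IsCyclicDatum K ϖ i g r u) (hu3 : (u : A) ^ 3 ∈ sexticOrder O i g) {x : A}
    (hx : ∃ f₀ ∈ sexticOrder O i g, ∃ f₁ ∈ sexticOrder O i g, ∃ f₂ ∈ sexticOrder O i g,
      x = f₀ + f₁ * u + f₂ * u ^ 2) :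
    ∃ f₀ ∈ sexticOrder O i g, ∃ f₁ ∈ sexticOrder O i g, ∃ f₂ ∈ sexticOrder O i g,
      u * x = f₀ + f₁ * u + f₂ * u ^ 2 := by
  obtain ⟨f₀, h₀, f₁, h₁, f₂, h₂, rfl⟩ := hx
  refine ⟨_, mul_mem (h.sextic.conj_mem h.conj h₂) hu3, _, h.sextic.conj_mem h.conj h₀, _,
    h.sextic.conj_mem h.conj h₁, ?_⟩
  simp only [pow_succ, pow_zero, one_mul, mul_assoc, Units.inv_mul_cancel_left, mul_add, Units.inv_mul,
    mul_one]
  abel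

/-- The order `O[i, g] + O[i, g] u + O[i, g] u²`, for `u³` in `O[i, g]`. -/
def order (h : IsCyclicDatum K ϖ i g r u) (hu3 : (u : A) ^ 3 ∈ sexticOrder O i g) :
    Subalgebra O A where
  carrier := {x | ∃ f₀ ∈ sexticOrder O i g, ∃ f₁ ∈ sexticOrder O i g, ∃ f₂ ∈ sexticOrder O i g,
    x = f₀ + f₁ * u + f₂ * u ^ 2}
  algebraMap_mem' c := ⟨_, Subalgebra.algebraMap_mem _ c, 0, zero_mem _, 0, zero_mem _, by simp⟩
  add_mem' := by
    rintro _ _ ⟨f₀, h₀, f₁, h₁, f₂, h₂, rfl⟩ ⟨f₀', h₀', f₁', h₁', f₂', h₂', rfl⟩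
    exact ⟨_, add_mem h₀ h₀', _, add_mem h₁ h₁', _, add_mem h₂ h₂', by
      simp only [add_mul]; abel⟩
  mul_mem' := by
    rintro _ y ⟨f₀, h₀, f₁, h₁, f₂, h₂, rfl⟩ hy
    have hu := h.exists_unit_mul_eq hu3 hy
    have huu := h.exists_unit_mul_eq hu3 hu
    obtain ⟨a₀, ha₀, a₁, ha₁, a₂, ha₂, ha⟩ := hy
    obtain ⟨b₀, hb₀, b₁, hb₁, b₂, hb₂, hb⟩ := hu
    obtain ⟨c₀, hc₀, c₁, hc₁, c₂, hc₂, hc⟩ := huu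
    refine ⟨f₀ * a₀ + f₁ * b₀ + f₂ * c₀,
      add_mem (add_mem (mul_mem h₀ ha₀) (mul_mem h₁ hb₀)) (mul_mem h₂ hc₀),
      f₀ * a₁ + f₁ * b₁ + f₂ * c₁,
      add_mem (add_mem (mul_mem h₀ ha₁) (mul_mem h₁ hb₁)) (mul_mem h₂ hc₁),
      f₀ * a₂ + f₁ * b₂ + f₂ * c₂,
      add_mem (add_mem (mul_mem h₀ ha₂) (mul_mem h₁ hb₂)) (mul_mem h₂ hc₂), ?_⟩
    have : (f₀ + f₁ * u + f₂ * u ^ 2) * y = f₀ * y + f₁ * (u * y) + f₂ * (u * (u * y)) := by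
      simp only [add_mul, mul_assoc, pow_two]
    rw [this, hc, hb, ha]
    simp only [add_mul, mul_add, mul_assoc]
    abel

omit [Nontrivial A] in
theorem isLatticeOrder_order (h : IsCyclicDatum K ϖ i g r u)
    (hu3 : (u : A) ^ 3 ∈ sexticOrder O i g) : IsLatticeOrder K (h.order hu3) := by
  constructor
  · have hfg := h.sextic.fg_sexticOrder
    have : Subalgebra.toSubmodule (h.order hu3) = Subalgebra.toSubmodule (sexticOrder O i g) ⊔
        (Subalgebra.toSubmodule (sexticOrder O i g)).map (LinearMap.mulRight O (u : A)) ⊔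
        (Subalgebra.toSubmodule (sexticOrder O i g)).map (LinearMap.mulRight O ((u : A) ^ 2)) := by
      ext x
      simp only [Submodule.mem_sup, Submodule.mem_map, Subalgebra.mem_toSubmodule,
        LinearMap.mulRight_apply]
      constructor
      · rintro ⟨f₀, h₀, f₁, h₁, f₂, h₂, rfl⟩
        exact ⟨_, ⟨f₀, h₀, _, ⟨f₁, h₁, rfl⟩, rfl⟩, _, ⟨f₂, h₂, rfl⟩, rfl⟩
      · rintro ⟨_, ⟨f₀, h₀, _, ⟨f₁, h₁, rfl⟩, rfl⟩, _, ⟨f₂, h₂, rfl⟩, rfl⟩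
        exact ⟨f₀, h₀, f₁, h₁, f₂, h₂, rfl⟩
    rw [this]
    exact (hfg.sup (hfg.map _)).sup (hfg.map _)
  · refine top_unique fun a _ ↦ ?_
    have key (w : A) (hw : ∀ f ∈ sexticOrder O i g, f * w ∈ h.order hu3) (f : A)
        (hf : f ∈ Algebra.adjoin K {i, g}) : f * w ∈ Submodule.span K (h.order hu3 : Set A) := by
      obtain ⟨n, hn⟩ := h.sextic.exists_pow_smul_mem hf
      have hK := pow_ne_zero n (h.sextic.algebraMap_ne_zero (K := K))
      have : f * w = (algebraMap O K ϖ ^ n)⁻¹ • ((ϖ ^ n • f) * w) := by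
        rw [← algebraMap_smul K (ϖ ^ n) f, map_pow, smul_mul_assoc, inv_smul_smul₀ hK]
      rw [this]
      exact Submodule.smul_mem _ _ (Submodule.subset_span (hw _ hn))
    obtain ⟨f₀, h₀, f₁, h₁, f₂, h₂, rfl⟩ := h.decomp a
    refine add_mem (add_mem ?_ (key _ ?_ _ h₁)) (key _ ?_ _ h₂)
    · rw [← mul_one f₀]
      exact key 1 (fun f hf ↦ ⟨f, hf, 0, zero_mem _, 0, zero_mem _, by simp⟩) _ h₀
    · exact fun f hf ↦ ⟨0, zero_mem _, f, hf, 0, zero_mem _, by simp⟩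
    · exact fun f hf ↦ ⟨0, zero_mem _, 0, zero_mem _, f, hf, by simp⟩

end IsCyclicDatum

end Cyclic

/-! ### Orders stable under an involution -/

section Stable

variable {O : Type u} {K : Type v} {A : Type w} [CommRing O] [IsDomain O] [IsDiscreteValuationRing O]
  [Field K] [Algebra O K] [IsFractionRing O K] [Ring A] [Nontrivial A] [Algebra O A] [Algebra K A]
  [IsScalarTower O K A] {ϖ : O} {i g : A} {r : ℕ} {u : Aˣ}

namespace AlgInvolution

omit [IsDomain O] [IsDiscreteValuationRing O] [IsFractionRing O K] [Nontrivial A] [CommRing O]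
  [Algebra O K] [Algebra O A] [IsScalarTower O K A] in
theorem map_pow (σ : AlgInvolution K A) (x : A) (n : ℕ) : σ.toLin (x ^ n) = σ.toLin x ^ n := by
  induction n with
  | zero => simp [σ.map_one]
  | succ n ih => rw [pow_succ, σ.map_mul_rev, ih, pow_succ']

omit [IsDomain O] [IsDiscreteValuationRing O] [IsFractionRing O K] [Nontrivial A] in
theorem map_algebraMap (σ : AlgInvolution K A) (c : O) :
    σ.toLin (algebraMap O A c) = algebraMap O A c := by
  rw [IsScalarTower.algebraMap_apply O K A, Algebra.algebraMap_eq_smul_one, map_smul, σ.map_one]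

omit [IsDomain O] [IsDiscreteValuationRing O] [IsFractionRing O K] [Nontrivial A] in
theorem map_mem_sexticOrder (σ : AlgInvolution K A) (hi : σ.toLin i = -i) (hg : σ.toLin g = g ^ 6)
    {x : A} (hx : x ∈ sexticOrder O i g) : σ.toLin x ∈ sexticOrder O i g := by
  induction hx using Algebra.adjoin_induction with
  | mem x hx =>
    rcases hx with rfl | rfl
    · rw [hi]; exact neg_mem IsSexticDatum.left_mem
    · rw [hg]; exact pow_mem IsSexticDatum.right_mem 6
  | algebraMap c => rw [σ.map_algebraMap]; exact Subalgebra.algebraMap_mem _ c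
  | add x y _ _ hx hy => rw [map_add]; exact add_mem hx hy
  | mul x y _ _ hx hy => rw [σ.map_mul_rev]; exact mul_mem hy hx

end AlgInvolution

omit [IsDomain O] [IsDiscreteValuationRing O] [IsFractionRing O K] [Nontrivial A] in
theorem mem_adjoin_of_mem_sexticOrder {x : A} (hx : x ∈ sexticOrder O i g) :
    x ∈ Algebra.adjoin K {i, g} := by
  induction hx using Algebra.adjoin_induction with
  | mem x hx => exact Algebra.subset_adjoin hx
  | algebraMap c =>
    rw [IsScalarTower.algebraMap_apply O K A]
    exact Subalgebra.algebraMap_mem _ _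
  | add x y _ _ hx hy => exact add_mem hx hy
  | mul x y _ _ hx hy => exact mul_mem hx hy

namespace IsCyclicDatum

/-- The involution maps `u` to the eigenspace of `u²`, and `σ(u)³ = σ(u³)` is integral. -/
theorem map_unit_mem_order (h : IsCyclicDatum K ϖ i g r u) {b : ℤ}
    (hub : HasOrder K ϖ i g b ((u : A) ^ 3)) (hb : b ≤ 1) (hu3 : (u : A) ^ 3 ∈ sexticOrder O i g)
    (σ : AlgInvolution K A) (hi : σ.toLin i = -i) (hg : σ.toLin g = g ^ 6) :
    σ.toLin u ∈ h.order hu3 := by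
  have h7 := pow_seven_eq_one_of_sum h.sextic.sum
  have hconj : σ.toLin u * g = g ^ (r * r) * σ.toLin u := by
    have h1 := congrArg σ.toLin h.conj
    rw [σ.map_mul_rev, σ.map_mul_rev, σ.map_pow, hg, ← pow_mul] at h1
    -- `σ(u) g⁻ʳ = g⁻¹ σ(u)`, and `-r` has an inverse modulo `7`
    have h2 (j : ℕ) : σ.toLin u * (g ^ (6 * r)) ^ j = (g ^ 6) ^ j * σ.toLin u := by
      induction j with
      | zero => simp
      | succ j ih => rw [pow_succ, ← mul_assoc, ih, mul_assoc, ← h1, ← mul_assoc, ← pow_succ]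
    rcases h.exponent with rfl | rfl
    · have h3 := h2 3
      rw [← pow_mul, ← pow_mul, pow_eq_pow_mod _ h7, pow_eq_pow_mod (6 * 3) h7] at h3
      simpa using h3
    · have h3 := h2 5
      rw [← pow_mul, ← pow_mul, pow_eq_pow_mod _ h7, pow_eq_pow_mod (6 * 5) h7] at h3
      rw [pow_eq_pow_mod (4 * 4) h7]
      simpa using h3
  obtain ⟨f₀, h₀, f₁, h₁, f₂, h₂, hdec⟩ := h.decomp (σ.toLin u)
  have hU : σ.toLin u = f₂ * ((u ^ 2 : Aˣ) : A) := by
    have h3 := (h.eigenComponent_eq h₀ h₁ h₂).2.2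
    rw [← hdec, eigenComponent_self h.sextic.sum hconj (Dvd.intro (r * r) (by ring))] at h3
    rw [Units.val_pow_eq_pow_val]
    exact h.seven_mul_injective h3
  have hsq : HasOrder K ϖ i g (b + b) (((u ^ 2 : Aˣ) : A) ^ 3) := by
    have := h.sextic.hasOrder_mul hub hub
    rwa [← pow_add, show (u : A) ^ (3 + 3) = ((u ^ 2 : Aˣ) : A) ^ 3 by
      rw [Units.val_pow_eq_pow_val, ← pow_mul]] at this
  have hf₂ : f₂ ∈ sexticOrder O i g := by
    refine h.sextic.mem_of_pow_three_mem h.conj_sq hsq (by omega) h.sextic.fg_sexticOrder le_rfl h₂ ?_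
    rw [← hU, ← σ.map_pow]
    exact σ.map_mem_sexticOrder hi hg hu3
  rw [hU, Units.val_pow_eq_pow_val]
  exact ⟨0, zero_mem _, 0, zero_mem _, f₂, hf₂, by simp⟩

theorem isStable_order (h : IsCyclicDatum K ϖ i g r u) {b : ℤ}
    (hub : HasOrder K ϖ i g b ((u : A) ^ 3)) (hb : b ≤ 1) (hu3 : (u : A) ^ 3 ∈ sexticOrder O i g)
    (σ : AlgInvolution K A) (hi : σ.toLin i = -i) (hg : σ.toLin g = g ^ 6) :
    IsStable σ (h.order hu3) := by
  have hU := h.map_unit_mem_order hub hb hu3 σ hi hg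
  have hS {f : A} (hf : f ∈ sexticOrder O i g) : σ.toLin f ∈ h.order hu3 :=
    ⟨_, σ.map_mem_sexticOrder hi hg hf, 0, zero_mem _, 0, zero_mem _, by simp⟩
  rintro _ ⟨f₀, h₀, f₁, h₁, f₂, h₂, rfl⟩
  rw [map_add, map_add, σ.map_mul_rev, σ.map_mul_rev, σ.map_pow]
  exact add_mem (add_mem (hS h₀) (mul_mem hU (hS h₁))) (mul_mem (pow_mem hU 2) (hS h₂))

/-- A maximal stable order containing `O[i, g]` is a maximal order, because there is a stable order
that contains every order containing `O[i, g]`. -/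
theorem isMaximalOrder_of_order_le_one (h : IsCyclicDatum K ϖ i g r u) {b : ℤ}
    (hub : HasOrder K ϖ i g b ((u : A) ^ 3)) (hb0 : 0 ≤ b) (hb : b ≤ 1)
    (σ : AlgInvolution K A) (hi : σ.toLin i = -i) (hg : σ.toLin g = g ^ 6) {R : Subalgebra O A}
    (hR : Maximal (fun S ↦ IsLatticeOrder K S ∧ IsStable σ S) R) (hle : sexticOrder O i g ≤ R) :
    IsMaximalOrder K R := by
  have hu3 : (u : A) ^ 3 ∈ sexticOrder O i g := IsSexticDatum.mem_of_hasOrder_of_nonneg hb0 hub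
  refine ⟨hR.prop.1, fun T hT hRT t ht ↦ ?_⟩
  have hle' (T : Subalgebra O A) (hT : IsLatticeOrder K T) (hRT : R ≤ T) : T ≤ h.order hu3 :=
    fun t ht ↦ h.exists_of_mem_order hub hb0 hb hT.1 (hle.trans hRT) ht
  exact hR.2 ⟨h.isLatticeOrder_order hu3, h.isStable_order hub hb hu3 σ hi hg⟩
    (hle' R hR.prop.1 le_rfl) (hle' T hT hRT ht)

/-- The scalar `ϖⁿ` as a unit of `A`. -/
noncomputable def scalarUnit (h : IsSexticDatum ϖ i g) (n : ℤ) : Aˣ :=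
  Units.map (algebraMap K A : K →* A)
    (Units.mk0 (algebraMap O K ϖ ^ n) (zpow_ne_zero n (h.algebraMap_ne_zero (K := K))))

omit [IsDomain O] [IsDiscreteValuationRing O] [Nontrivial A] [IsScalarTower O K A] in
theorem scalarUnit_val_mul (h : IsSexticDatum ϖ i g) (n : ℤ) (x : A) :
    (scalarUnit (K := K) h n : A) * x = (algebraMap O K ϖ ^ n) • x := by
  rw [Algebra.smul_def]; rfl

/-- The element `u³` commutes with `g`, hence lies in `F`. -/
theorem exists_hasOrder_pow_three (h : IsCyclicDatum K ϖ i g 2 u) :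
    ∃ n : ℤ, HasOrder K ϖ i g n ((u : A) ^ 3) := by
  have h7 := pow_seven_eq_one_of_sum h.sextic.sum
  have hconj : (u : A) ^ 3 * g = g ^ 1 * (u : A) ^ 3 := by
    have h2 := h.conj_sq
    rw [Units.val_pow_eq_pow_val] at h2
    rw [pow_succ', mul_assoc, h2, ← mul_assoc, pow_mul_eq_of_eigen h.conj, mul_assoc,
      pow_eq_pow_mod _ h7]
  obtain ⟨f₀, h₀, f₁, h₁, f₂, h₂, hdec⟩ := h.decomp ((u : A) ^ 3)
  have h3 := (h.eigenComponent_eq h₀ h₁ h₂).1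
  rw [← hdec, eigenComponent_self h.sextic.sum hconj (by norm_num)] at h3
  refine h.sextic.exists_hasOrder ?_ (by rw [← Units.val_pow_eq_pow_val]; exact Units.ne_zero _)
  rw [h.seven_mul_injective h3]
  exact h₀

omit [IsDomain O] [IsDiscreteValuationRing O] [Nontrivial A] [IsScalarTower O K A] in
/-- If `u³` has order `3 q` or `3 q + 1`, then `u` can be replaced by `ϖ ^ (-q) u`. -/
theorem exists_order_le_one_of_lt (h : IsCyclicDatum K ϖ i g 2 u) {n q : ℤ}
    (hn : HasOrder K ϖ i g n ((u : A) ^ 3)) (hq : 3 * q ≤ n) (hq' : n ≤ 3 * q + 1) :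
    ∃ (r' : ℕ) (u' : Aˣ) (b : ℤ), IsCyclicDatum K ϖ i g r' u' ∧
      HasOrder K ϖ i g b ((u' : A) ^ 3) ∧ 0 ≤ b ∧ b ≤ 1 := by
  have hK := h.sextic.algebraMap_ne_zero (K := K)
  obtain ⟨e, he, hn⟩ := hn
  refine ⟨2, scalarUnit (K := K) h.sextic (-q) * u, n - 3 * q,
    ⟨h.sextic, Or.inl rfl, ?_, ?_⟩, ?_, by omega, by omega⟩
  · rw [Units.val_mul, scalarUnit_val_mul, smul_mul_assoc, h.conj, mul_smul_comm]
  · intro a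
    obtain ⟨f₀, h₀, f₁, h₁, f₂, h₂, rfl⟩ := h.decomp a
    refine ⟨f₀, h₀, (algebraMap O K ϖ ^ q) • f₁, Subalgebra.smul_mem _ h₁ _,
      (algebraMap O K ϖ ^ (2 * q)) • f₂, Subalgebra.smul_mem _ h₂ _, ?_⟩
    rw [Units.val_mul, scalarUnit_val_mul, smul_pow, smul_mul_smul_comm, smul_mul_smul_comm,
      ← zpow_natCast, ← zpow_mul, ← zpow_add₀ hK, ← zpow_add₀ hK, add_neg_cancel,
      show 2 * q + -q * ((2 : ℕ) : ℤ) = 0 by push_cast; ring, zpow_zero, one_smul, one_smul]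
  · refine ⟨e, he, ?_⟩
    rw [Units.val_mul, scalarUnit_val_mul, smul_pow, hn, smul_smul, ← zpow_natCast, ← zpow_mul,
      ← zpow_add₀ hK]
    congr 2
    push_cast
    ring

omit [IsDomain O] [IsDiscreteValuationRing O] [Nontrivial A] in
/-- If `u³` has order `3 q + 2`, then `u` can be replaced by `ϖ ^ (-(2 q + 1)) u²`, whose cube
has order `1`. -/
theorem exists_order_le_one_of_eq (h : IsCyclicDatum K ϖ i g 2 u) {n q : ℤ}
    (hn : HasOrder K ϖ i g n ((u : A) ^ 3)) (hnq : n = 3 * q + 2) :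
    ∃ (r' : ℕ) (u' : Aˣ) (b : ℤ), IsCyclicDatum K ϖ i g r' u' ∧
      HasOrder K ϖ i g b ((u' : A) ^ 3) ∧ 0 ≤ b ∧ b ≤ 1 := by
  have hK := h.sextic.algebraMap_ne_zero (K := K)
  obtain ⟨e, he, hn⟩ := hn
  refine ⟨4, scalarUnit (K := K) h.sextic (-(2 * q + 1)) * u ^ 2, 1,
    ⟨h.sextic, Or.inr rfl, ?_, ?_⟩, ⟨e * e, he.mul he, ?_⟩, by norm_num, le_rfl⟩
  · rw [Units.val_mul, scalarUnit_val_mul, smul_mul_assoc, h.conj_sq, mul_smul_comm]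
  · intro a
    obtain ⟨f₀, h₀, f₁, h₁, f₂, h₂, rfl⟩ := h.decomp a
    obtain ⟨-, e', he', -, hee⟩ := he
    refine ⟨f₀, h₀, (algebraMap O K ϖ ^ (2 * q + 1)) • f₂, Subalgebra.smul_mem _ h₂ _,
      (algebraMap O K ϖ ^ q) • (f₁ * e'),
      Subalgebra.smul_mem _ (mul_mem h₁ (mem_adjoin_of_mem_sexticOrder he')) _, ?_⟩
    rw [Units.val_mul, Units.val_pow_eq_pow_val, scalarUnit_val_mul]
    have h1 : ((algebraMap O K ϖ ^ (2 * q + 1)) • f₂) *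
        ((algebraMap O K ϖ ^ (-(2 * q + 1))) • (u : A) ^ 2) = f₂ * u ^ 2 := by
      rw [smul_mul_smul_comm, ← zpow_add₀ hK, add_neg_cancel, zpow_zero, one_smul]
    have hu4 : ((u : A) ^ 2) ^ 2 = (algebraMap O K ϖ ^ n) • (e * u) := by
      rw [← pow_mul, pow_succ _ 3, hn, smul_mul_assoc]
    have h2 : ((algebraMap O K ϖ ^ q) • (f₁ * e')) *
        ((algebraMap O K ϖ ^ (-(2 * q + 1))) • (u : A) ^ 2) ^ 2 = f₁ * u := by
      rw [smul_pow, hu4, smul_smul, smul_mul_smul_comm, mul_assoc f₁, ← mul_assoc e', hee, one_mul,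
        ← zpow_natCast, ← zpow_mul, ← zpow_add₀ hK, ← zpow_add₀ hK,
        show q + (-(2 * q + 1) * ((2 : ℕ) : ℤ) + n) = 0 by rw [hnq]; push_cast; ring, zpow_zero,
        one_smul]
    rw [h1, h2, add_right_comm]
  · rw [Units.val_mul, Units.val_pow_eq_pow_val, scalarUnit_val_mul, smul_pow, pow_right_comm, hn,
      smul_pow, smul_smul, pow_two e, ← zpow_natCast, ← zpow_mul, ← zpow_natCast,
      ← zpow_mul, ← zpow_add₀ hK]
    congr 2
    rw [hnq]
    push_cast
    ring

/-- After multiplication by a power of `ϖ`, either `u` or `u²` has a cube of order `0` or `1`. -/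
theorem exists_order_le_one (h : IsCyclicDatum K ϖ i g 2 u) :
    ∃ (r' : ℕ) (u' : Aˣ) (b : ℤ), IsCyclicDatum K ϖ i g r' u' ∧
      HasOrder K ϖ i g b ((u' : A) ^ 3) ∧ 0 ≤ b ∧ b ≤ 1 := by
  obtain ⟨n, hn⟩ := h.exists_hasOrder_pow_three
  by_cases h2 : n % 3 = 2
  · exact h.exists_order_le_one_of_eq (q := n / 3) hn (by omega)
  · exact h.exists_order_le_one_of_lt (q := n / 3) hn (by omega) (by omega)

end IsCyclicDatum

omit [IsDomain O] [IsDiscreteValuationRing O] [Algebra O K] [IsFractionRing O K] [Nontrivial A]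
  [IsScalarTower O K A] in
/-- Adjoining the central skew element `i` to a stable order gives a stable order. -/
theorem mem_of_maximal_stable (h : IsSexticDatum ϖ i g) (σ : AlgInvolution K A)
    (hi : σ.toLin i = -i) {R : Subalgebra O A}
    (hR : Maximal (fun S ↦ IsLatticeOrder K S ∧ IsStable σ S) R) : i ∈ R := by
  have hmulmul (a b c d : A) : (a + b * i) * (c + d * i) = (a * c - b * d) + (a * d + b * c) * i := by
    have h1 : b * i * c = b * c * i := by rw [mul_assoc, h.central, mul_assoc]
    have h2 : b * i * (d * i) = -(b * d) := by
      rw [mul_assoc b, ← mul_assoc i, h.central, mul_assoc d, h.sq, mul_neg_one, mul_neg]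
    rw [add_mul, mul_add, mul_add, h1, h2, add_mul, mul_assoc a d]
    abel
  let R' : Subalgebra O A :=
    { carrier := {x | ∃ a ∈ R, ∃ b ∈ R, x = a + b * i}
      algebraMap_mem' := fun c ↦ ⟨_, Subalgebra.algebraMap_mem _ c, 0, zero_mem _, by simp⟩
      add_mem' := by
        rintro _ _ ⟨a, ha, b, hb, rfl⟩ ⟨c, hc, d, hd, rfl⟩
        exact ⟨_, add_mem ha hc, _, add_mem hb hd, by rw [add_mul]; abel⟩
      mul_mem' := by
        rintro _ _ ⟨a, ha, b, hb, rfl⟩ ⟨c, hc, d, hd, rfl⟩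
        exact ⟨_, sub_mem (mul_mem ha hc) (mul_mem hb hd), _,
          add_mem (mul_mem ha hd) (mul_mem hb hc), hmulmul a b c d⟩ }
  have hle : R ≤ R' := fun x hx ↦ ⟨x, hx, 0, zero_mem _, by simp⟩
  have hlat : IsLatticeOrder K R' := by
    constructor
    · have : Subalgebra.toSubmodule R' = Subalgebra.toSubmodule R ⊔
          (Subalgebra.toSubmodule R).map (LinearMap.mulRight O i) := by
        ext x
        simp only [Submodule.mem_sup, Submodule.mem_map, Subalgebra.mem_toSubmodule,
          LinearMap.mulRight_apply]
        constructor
        · rintro ⟨a, ha, b, hb, rfl⟩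
          exact ⟨_, ha, _, ⟨b, hb, rfl⟩, rfl⟩
        · rintro ⟨_, ha, _, ⟨b, hb, rfl⟩, rfl⟩
          exact ⟨_, ha, _, hb, rfl⟩
      rw [this]
      exact hR.prop.1.1.sup (hR.prop.1.1.map _)
    · exact top_unique (hR.prop.1.2.symm.le.trans (Submodule.span_mono hle))
  have hst : IsStable σ R' := by
    rintro _ ⟨a, ha, b, hb, rfl⟩
    refine ⟨_, hR.prop.2 a ha, _, neg_mem (hR.prop.2 b hb), ?_⟩
    rw [map_add, σ.map_mul_rev, hi, neg_mul, neg_mul, h.central]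
  exact hR.2 ⟨hlat, hst⟩ hle ⟨0, zero_mem _, 1, one_mem _, by simp⟩

/-- A maximal stable order containing `g` is a maximal order. -/
theorem IsCyclicDatum.isMaximalOrder (h : IsCyclicDatum K ϖ i g 2 u) (σ : AlgInvolution K A)
    (hi : σ.toLin i = -i) (hg : σ.toLin g = g ^ 6) {R : Subalgebra O A}
    (hR : Maximal (fun S ↦ IsLatticeOrder K S ∧ IsStable σ S) R) (hgR : g ∈ R) :
    IsMaximalOrder K R := by
  obtain ⟨r', u', b, h', hub, hb0, hb⟩ := h.exists_order_le_one
  refine h'.isMaximalOrder_of_order_le_one hub hb0 hb σ hi hg hR (Algebra.adjoin_le ?_)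
  rintro _ (rfl | rfl)
  · exact mem_of_maximal_stable h.sextic σ hi hR
  · exact hgR

end Stable

/-! ### The division algebra as a cyclic algebra -/

section Global

variable {k : Type u} {ℓ : Type v} {D : Type w} [Field k] [NumberField k] [Field ℓ] [NumberField ℓ]
  [Algebra k ℓ] [DivisionRing D] [Algebra k D] [Algebra ℓ D] [IsScalarTower k ℓ D]

omit [Algebra k D] [IsScalarTower k ℓ D] in
/-- An element of order seven generates a cubic extension `K` of `ℓ`, and its period
`g + g² + g⁴` lies in `ℓ`. -/
theorem exists_period_of_orderOf_eq_seven (h : IsC20 k ℓ) [Algebra.IsCentral ℓ D]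
    (h9 : finrank ℓ D = 9) {g : Dˣ} (hg : orderOf g = 7)
    (hc : (g : D) ∉ (algebraMap ℓ D).range) :
    (∃ η : ℓ, η ^ 2 + η + 2 = 0 ∧ (g : D) + g ^ 2 + g ^ 4 = algebraMap ℓ D η) ∧
      ∑ j ∈ Finset.range 7, (g : D) ^ j = 0 ∧
      finrank ℓ (Algebra.adjoin ℓ {(g : D)}) = 3 := by
  obtain ⟨K, _, _, f, x, hxg, h3, htop, hx⟩ := exists_cubic_subfield_of_orderOf h9 hg hc
  obtain ⟨-, i, -, hi, -, -⟩ := id h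
  obtain ⟨-, η, hη⟩ := eq_seven_of_isPrimitiveRoot_primePow h.finrank_le hi
    h.not_isSquare_neg_three (p := 7) (a := 1) h3 (by norm_num) (by simpa using hx) htop
  have hsum := hx.geom_sum_eq_zero (by norm_num)
  refine ⟨⟨η, ?_, ?_⟩, ?_, ?_⟩
  · apply (algebraMap ℓ K).injective
    simp only [Finset.sum_range_succ, Finset.sum_range_zero, zero_add, pow_zero, pow_one] at hsum
    rw [map_add, map_add, map_pow, hη, map_ofNat, map_zero, quadratic_period_seven hsum]
  · rw [← hxg, ← f.commutes, hη, map_add, map_add, map_pow, map_pow]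
  · rw [← hxg]
    simpa using congrArg f hsum
  · have : Algebra.adjoin ℓ {(g : D)} = f.range := by
      rw [← Algebra.map_top, ← htop, AlgHom.map_adjoin, Set.image_singleton, hxg]
    rw [this, ← h3]
    exact (LinearEquiv.finrank_eq
      (AlgEquiv.ofInjective f (f : K →+* D).injective).toLinearEquiv).symm

/-- Only the exponents `1`, `2`, `4` occur as eigenvalues of conjugation by `g` if the period
`g + g² + g⁴` is central. -/
theorem seven_mul_eq_sum_eigenComponent {g : D} {η : ℓ} (hη : η ^ 2 + η + 2 = 0)
    (hg : g + g ^ 2 + g ^ 4 = algebraMap ℓ D η) (hsum : ∑ j ∈ Finset.range 7, g ^ j = 0) (x : D) :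
    7 * x = eigenComponent g 1 x + eigenComponent g 2 x + eigenComponent g 4 x := by
  have h7 := pow_seven_eq_one_of_sum hsum
  have key (m : ℕ) (c : ℓ) (hc : g ^ m + g ^ (m * 2) + g ^ (m * 4) = algebraMap ℓ D c)
      (hcη : η ≠ c) : eigenComponent g m x = 0 := by
    set a := eigenComponent g m x with ha
    have he : a * g = g ^ m * a := eigenComponent_mul h7 m x
    have h1 : a * (g + g ^ 2 + g ^ 4) = (g ^ m + g ^ (m * 2) + g ^ (m * 4)) * a := by
      rw [mul_add, mul_add, he, pow_mul_eq_of_eigen he, pow_mul_eq_of_eigen he, add_mul, add_mul]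
    rw [hg, hc, ← Algebra.commutes, ← sub_eq_zero, ← sub_mul, ← map_sub] at h1
    refine (mul_eq_zero.1 h1).resolve_left ?_
    rw [map_eq_zero_iff _ (algebraMap ℓ D).injective, sub_eq_zero]
    exact hcη
  have hother : g ^ 3 + g ^ 6 + g ^ 5 = algebraMap ℓ D (-1 - η) := by
    simp only [Finset.sum_range_succ, Finset.sum_range_zero, zero_add, pow_zero, pow_one] at hsum
    rw [map_sub, map_neg, map_one, ← hg, ← sub_eq_zero, ← hsum]
    abel
  have hne : η ≠ -1 - η := fun h ↦ by
    have : (7 : ℓ) = 0 := by linear_combination 4 * hη - (2 * η + 1) * h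
    norm_num at this
  have h0 : eigenComponent g 0 x = 0 := key 0 3 (by rw [map_ofNat]; norm_num) fun h ↦ by
    have : (14 : ℓ) = 0 := by linear_combination hη - (η + 4) * h
    norm_num at this
  have h3 : eigenComponent g 3 x = 0 := key 3 (-1 - η) (by
    rw [pow_eq_pow_mod (3 * 4) h7]; exact hother) hne
  have h5 : eigenComponent g 5 x = 0 := key 5 (-1 - η) (by
    rw [pow_eq_pow_mod (5 * 2) h7, pow_eq_pow_mod (5 * 4) h7, ← hother]
    simp only [Nat.reduceMul, Nat.reduceMod]
    abel) hne
  have h6 : eigenComponent g 6 x = 0 := key 6 (-1 - η) (by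
    rw [pow_eq_pow_mod (6 * 2) h7, pow_eq_pow_mod (6 * 4) h7, ← hother]
    simp only [Nat.reduceMul, Nat.reduceMod]
    abel) hne
  rw [← sum_eigenComponent hsum]
  simp only [Finset.sum_range_succ, Finset.sum_range_zero, h0, h3, h5, h6, zero_add, add_zero]

/-- An element inducing the automorphism `g ↦ g²`: since `g` is not central, one of the exponents `2`
and `4` occurs, and the square of an element for the exponent `4` is one for the exponent `2`. -/
theorem exists_conj_eq_sq [Algebra.IsCentral ℓ D] {g : D} (hc : g ∉ (algebraMap ℓ D).range) {η : ℓ}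
    (hη : η ^ 2 + η + 2 = 0) (hg : g + g ^ 2 + g ^ 4 = algebraMap ℓ D η)
    (hsum : ∑ j ∈ Finset.range 7, g ^ j = 0) : ∃ u : Dˣ, (u : D) * g = g ^ 2 * u := by
  have h7 := pow_seven_eq_one_of_sum hsum
  have : CharZero D := charZero_of_injective_algebraMap (algebraMap ℓ D).injective
  by_cases h2 : ∃ x, eigenComponent g 2 x ≠ 0
  · obtain ⟨x, hx⟩ := h2
    exact ⟨Units.mk0 _ hx, eigenComponent_mul h7 2 x⟩
  by_cases h4 : ∃ x, eigenComponent g 4 x ≠ 0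
  · obtain ⟨x, hx⟩ := h4
    refine ⟨Units.mk0 _ hx ^ 2, ?_⟩
    have he := eigenComponent_mul h7 4 x
    rw [Units.val_pow_eq_pow_val, Units.val_mk0, pow_two, mul_assoc, he, ← mul_assoc,
      pow_mul_eq_of_eigen he, mul_assoc, pow_eq_pow_mod (4 * 4) h7]
  push Not at h2 h4
  refine (hc (Algebra.IsCentral.out (K := ℓ) (Subalgebra.mem_center_iff.2 fun x ↦ ?_))).elim
  have he := eigenComponent_mul h7 1 x
  have hx := seven_mul_eq_sum_eigenComponent hη hg hsum x
  rw [h2, h4, add_zero, add_zero] at hx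
  rw [← hx, pow_one, mul_assoc, ← mul_assoc g] at he
  rw [show g * 7 = 7 * g from (Nat.cast_commute 7 g).symm, mul_assoc] at he
  exact mul_left_cancel₀ (by norm_num) he

theorem eigen_inv {g a : D} {m : ℕ} (ha : a * g = g ^ m * a) (ha0 : a ≠ 0) :
    a⁻¹ * g ^ m = g * a⁻¹ := by
  rw [inv_mul_eq_iff_eq_mul₀ ha0, ← mul_assoc, ha, mul_assoc, mul_inv_cancel₀ ha0, mul_one]

/-- The division algebra is the sum of the translates of the centralizer of `g` by `1`, `u`, `u²`. -/
theorem exists_centralizer_decomposition {g : D} {η : ℓ}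
    (hη : η ^ 2 + η + 2 = 0) (hg : g + g ^ 2 + g ^ 4 = algebraMap ℓ D η)
    (hsum : ∑ j ∈ Finset.range 7, g ^ j = 0) {u : Dˣ} (hu : (u : D) * g = g ^ 2 * u) (x : D) :
    ∃ c₀ c₁ c₂ : D, c₀ * g = g * c₀ ∧ c₁ * g = g * c₁ ∧ c₂ * g = g * c₂ ∧
      x = c₀ + c₁ * u + c₂ * u ^ 2 := by
  have h7 := pow_seven_eq_one_of_sum hsum
  have : CharZero D := charZero_of_injective_algebraMap (algebraMap ℓ D).injective
  have hu2 : (u : D) ^ 2 * g = g ^ 4 * u ^ 2 := by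
    rw [pow_two, mul_assoc, hu, ← mul_assoc, pow_mul_eq_of_eigen hu, mul_assoc]
  -- the quotient of two elements of the same eigenspace commutes with `g`
  have key {a w : D} {m m' : ℕ} (hmm : m' * m % 7 = 1) (hw0 : w ≠ 0) (hw : w * g = g ^ m * w)
      (ha : a * g = g ^ m * a) : 7⁻¹ * a * w⁻¹ * g = g * (7⁻¹ * a * w⁻¹) := by
    have h1 : w⁻¹ * g = g ^ m' * w⁻¹ := by
      have h3 (j : ℕ) : w⁻¹ * (g ^ m) ^ j = g ^ j * w⁻¹ := by
        induction j with
        | zero => simp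
        | succ j ih => rw [pow_succ, ← mul_assoc, ih, mul_assoc, eigen_inv hw hw0, ← mul_assoc,
            ← pow_succ]
      have h4 := h3 m'
      rwa [← pow_mul, mul_comm m, pow_eq_pow_mod _ h7, hmm, pow_one] at h4
    rw [mul_assoc, h1, ← mul_assoc, mul_assoc (7⁻¹ : D), pow_mul_eq_of_eigen ha, mul_comm m,
      pow_eq_pow_mod _ h7, hmm, pow_one]
    rw [← mul_assoc, show (7⁻¹ : D) * g = g * 7⁻¹ from ((Nat.cast_commute 7 g).inv_left₀).eq]
    simp only [mul_assoc]
  have hu0 : (u : D) ≠ 0 := u.ne_zero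
  refine ⟨7⁻¹ * eigenComponent g 1 x * 1⁻¹, 7⁻¹ * eigenComponent g 2 x * (u : D)⁻¹,
    7⁻¹ * eigenComponent g 4 x * ((u : D) ^ 2)⁻¹,
    key (m' := 1) (by norm_num) one_ne_zero (by simp) (eigenComponent_mul h7 1 x),
    key (m' := 4) (by norm_num) hu0 hu (eigenComponent_mul h7 2 x),
    key (m' := 2) (by norm_num) (pow_ne_zero 2 hu0) hu2 (eigenComponent_mul h7 4 x), ?_⟩
  rw [inv_mul_cancel_right₀ hu0, inv_mul_cancel_right₀ (pow_ne_zero 2 hu0), inv_one, mul_one,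
    ← mul_add, ← mul_add, ← seven_mul_eq_sum_eigenComponent hη hg hsum,
    inv_mul_cancel_left₀ (by norm_num)]

/-- The centralizer of `g` is `ℓ[g]`: its translates by `1`, `u`, `u²` are linearly independent. -/
theorem mem_adjoin_of_commute (h9 : finrank ℓ D = 9) {g : D}
    (hsum : ∑ j ∈ Finset.range 7, g ^ j = 0) (h3 : finrank ℓ (Algebra.adjoin ℓ {g}) = 3)
    {u : Dˣ} (hu : (u : D) * g = g ^ 2 * u) {c : D} (hc : c * g = g * c) :
    c ∈ Algebra.adjoin ℓ {g} := by
  have h7 := pow_seven_eq_one_of_sum hsum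
  have : CharZero D := charZero_of_injective_algebraMap (algebraMap ℓ D).injective
  have hfin : FiniteDimensional ℓ D := FiniteDimensional.of_finrank_pos (by omega)
  set C := Subalgebra.toSubmodule (Subalgebra.centralizer ℓ {g}) with hC
  have hmem {x : D} : x ∈ C ↔ g * x = x * g := by
    rw [hC, Subalgebra.mem_toSubmodule, Subalgebra.mem_centralizer_iff]; simp
  let L : (C × C × C) →ₗ[ℓ] D :=
    (C.subtype.coprod (((LinearMap.mulRight ℓ (u : D)).comp C.subtype).coprod
      ((LinearMap.mulRight ℓ ((u : D) ^ 2)).comp C.subtype)))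
  have hL : Function.Injective L := by
    rw [← LinearMap.ker_eq_bot, LinearMap.ker_eq_bot']
    rintro ⟨⟨c₀, h₀⟩, ⟨c₁, h₁⟩, ⟨c₂, h₂⟩⟩ h
    replace h : c₀ + (c₁ * u + c₂ * (u : D) ^ 2) = 0 := h
    rw [hmem] at h₀ h₁ h₂
    have e₀ : c₀ * g = g ^ 1 * c₀ := by rw [pow_one, h₀]
    have e₁ : c₁ * u * g = g ^ 2 * (c₁ * u) := by
      rw [mul_assoc, hu, ← mul_assoc, ← mul_assoc]
      congr 1
      exact ((show Commute c₁ g from h₁.symm).pow_right 2)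
    have e₂ : c₂ * u ^ 2 * g = g ^ 4 * (c₂ * u ^ 2) := by
      have hu2 : (u : D) ^ 2 * g = g ^ 4 * u ^ 2 := by
        rw [pow_two, mul_assoc, hu, ← mul_assoc, pow_mul_eq_of_eigen hu, mul_assoc]
      rw [mul_assoc, hu2, ← mul_assoc, ← mul_assoc]
      congr 1
      exact ((show Commute c₂ g from h₂.symm).pow_right 4)
    have hz (m : ℕ) : eigenComponent g m (0 : D) = 0 := by simp [eigenComponent]
    have z₀ := hz 1
    have z₁ := hz 2
    have z₂ := hz 4
    rw [← h, eigenComponent_add, eigenComponent_add, h] at z₀ z₁ z₂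
    rw [eigenComponent_self hsum e₀ (by decide), eigenComponent_eq_zero hsum e₁ (by decide),
      eigenComponent_eq_zero hsum e₂ (by decide), add_zero, add_zero] at z₀
    rw [eigenComponent_eq_zero hsum e₀ (by decide), eigenComponent_self hsum e₁ (by decide),
      eigenComponent_eq_zero hsum e₂ (by decide), add_zero, zero_add] at z₁
    rw [eigenComponent_eq_zero hsum e₀ (by decide), eigenComponent_eq_zero hsum e₁ (by decide),
      eigenComponent_self hsum e₂ (by decide), zero_add, zero_add] at z₂
    have hu0 : (u : D) ≠ 0 := u.ne_zero
    have h70 : (7 : D) ≠ 0 := by norm_num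
    replace z₀ := (mul_eq_zero.1 z₀).resolve_left h70
    replace z₁ := (mul_eq_zero.1 ((mul_eq_zero.1 z₁).resolve_left h70)).resolve_right hu0
    replace z₂ := (mul_eq_zero.1 ((mul_eq_zero.1 z₂).resolve_left h70)).resolve_right
      (pow_ne_zero 2 hu0)
    subst z₀ z₁ z₂
    rfl
  have hdim := LinearMap.finrank_le_finrank_of_injective hL
  rw [finrank_prod, finrank_prod, h9] at hdim
  have hle : Subalgebra.toSubmodule (Algebra.adjoin ℓ {g}) ≤ C := by
    rw [hC, OrderEmbedding.le_iff_le, Algebra.adjoin_le_iff, Set.singleton_subset_iff,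
      SetLike.mem_coe, Subalgebra.mem_centralizer_iff]
    simp
  have heq := Submodule.eq_of_le_of_finrank_le hle (by
    change _ ≤ finrank ℓ (Algebra.adjoin ℓ {g})
    rw [h3]; omega)
  have hcC : c ∈ C := hmem.2 hc.symm
  rwa [← heq, Subalgebra.mem_toSubmodule] at hcC

omit [NumberField k] [NumberField ℓ] in
theorem mem_adjoin_pair_of_mem_adjoin {i : ℓ} (hi : i ^ 2 = -1)
    (hℓ : IntermediateField.adjoin k {i} = ⊤) {g c : D} (hc : c ∈ Algebra.adjoin ℓ {g}) :
    c ∈ Algebra.adjoin k {algebraMap ℓ D i, g} := by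
  induction hc using Algebra.adjoin_induction with
  | mem x hx => exact Algebra.subset_adjoin (Or.inr hx)
  | algebraMap a =>
    obtain ⟨p, q, rfl⟩ := exists_add_mul_of_adjoin_eq_top (d := (-1 : k)) (by simpa using hi) hℓ a
    rw [map_add, map_mul, ← IsScalarTower.algebraMap_apply, ← IsScalarTower.algebraMap_apply]
    exact add_mem (Subalgebra.algebraMap_mem _ _)
      (mul_mem (Subalgebra.algebraMap_mem _ _) (Algebra.subset_adjoin (Or.inl rfl)))
  | add x y _ _ hx hy => exact add_mem hx hy
  | mul x y _ _ hx hy => exact mul_mem hx hy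

omit [NumberField k] [NumberField ℓ] in
/-- An involution of the second kind of `ℓ = k(i)` maps `i` to `-i`. -/
theorem map_eq_neg_of_second_kind {i : ℓ} (hi : i ^ 2 = -1)
    (hℓ : IntermediateField.adjoin k {i} = ⊤) {σ : AlgInvolution k D}
    (hσ : ∃ a : ℓ, σ.toLin (algebraMap ℓ D a) ≠ algebraMap ℓ D a) :
    σ.toLin (algebraMap ℓ D i) = -algebraMap ℓ D i := by
  set I := algebraMap ℓ D i with hI
  have hI2 : I * I = -1 := by rw [hI, ← map_mul, ← pow_two, hi, map_neg, map_one]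
  have hne : σ.toLin I ≠ I := by
    intro h
    obtain ⟨a, ha⟩ := hσ
    obtain ⟨p, q, rfl⟩ := exists_add_mul_of_adjoin_eq_top (d := (-1 : k)) (by simpa using hi) hℓ a
    apply ha
    rw [map_add, map_mul, ← IsScalarTower.algebraMap_apply, ← IsScalarTower.algebraMap_apply, ← hI,
      ← Algebra.smul_def, Algebra.algebraMap_eq_smul_one, map_add, map_smul, map_smul, σ.map_one, h]
  have hcomm : σ.toLin I * I = I * σ.toLin I := (Algebra.commutes i _).symm
  have hsq : σ.toLin I * σ.toLin I = -1 := by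
    rw [← σ.map_mul_rev, hI2, map_neg, σ.map_one]
  have : (σ.toLin I - I) * (σ.toLin I + I) = 0 := by
    rw [sub_mul, mul_add, mul_add, hsq, hI2, hcomm]; abel
  exact eq_neg_of_add_eq_zero_left ((mul_eq_zero.1 this).resolve_left (sub_ne_zero.2 hne))

end Global

/-! ### The places over three -/

section Residue

variable {k : Type u} [Field k] [NumberField k]

/-- If two places of a quadratic field lie over `3`, the residue fields are prime fields. -/
theorem absNorm_eq_three (hk : finrank ℚ k ≤ 2) {v v' : HeightOneSpectrum (𝓞 k)} (hne : v ≠ v')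
    (hv : (3 : 𝓞 k) ∈ v.asIdeal) (hv' : (3 : 𝓞 k) ∈ v'.asIdeal) : Ideal.absNorm v.asIdeal = 3 := by
  have hcop : IsCoprime v.asIdeal v'.asIdeal := by
    rw [Ideal.isCoprime_iff_sup_eq]
    refine v.isMaximal.coprime_of_ne v'.isMaximal fun h ↦ hne (HeightOneSpectrum.ext h)
  have hle : Ideal.span {(3 : 𝓞 k)} ≤ v.asIdeal * v'.asIdeal := by
    rw [Ideal.mul_eq_inf_of_isCoprime hcop, le_inf_iff, Ideal.span_singleton_le_iff_mem,
      Ideal.span_singleton_le_iff_mem]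
    exact ⟨hv, hv'⟩
  -- the product of the two norms divides the norm `3 ^ [k : ℚ]` of `3`
  have hdvd := Ideal.absNorm_dvd_absNorm_of_le hle
  rw [map_mul, Ideal.absNorm_span_singleton,
    show (3 : 𝓞 k) = algebraMap ℤ (𝓞 k) 3 by simp, Algebra.norm_algebraMap,
    NumberField.RingOfIntegers.rank,
    Int.natAbs_pow] at hdvd
  change _ ∣ 3 ^ finrank ℚ k at hdvd
  obtain ⟨a, ha, hva⟩ := (Nat.dvd_prime_pow Nat.prime_three).1 ((Dvd.intro _ rfl).trans hdvd)
  obtain ⟨b, hb, hvb⟩ := (Nat.dvd_prime_pow Nat.prime_three).1 ((Dvd.intro_left _ rfl).trans hdvd)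
  have ha0 : a ≠ 0 := by
    rintro rfl
    exact v.isPrime.ne_top (Ideal.absNorm_eq_one_iff.1 hva)
  have hb0 : b ≠ 0 := by
    rintro rfl
    exact v'.isPrime.ne_top (Ideal.absNorm_eq_one_iff.1 hvb)
  rw [hva, hvb, ← pow_add, Nat.pow_dvd_pow_iff_le_right (by norm_num)] at hdvd
  rw [hva, show a = 1 by omega, pow_one]

omit [NumberField k] in
theorem two_notMem_of_three_mem {v : HeightOneSpectrum (𝓞 k)} (hv : (3 : 𝓞 k) ∈ v.asIdeal) :
    (2 : 𝓞 k) ∉ v.asIdeal := fun h2 ↦ by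
  refine v.isPrime.ne_top ((Ideal.eq_top_iff_one _).2 ?_)
  have := sub_mem hv h2
  norm_num at this
  exact this

theorem exists_natCast_sub_mem {v : HeightOneSpectrum (𝓞 k)} (hv : (3 : 𝓞 k) ∈ v.asIdeal)
    (hcard : Ideal.absNorm v.asIdeal = 3) (x : 𝓞 k) :
    ∃ n : Fin 3, x - (n : ℕ) ∈ v.asIdeal := by
  rw [Ideal.absNorm_apply, Submodule.cardQuot_apply] at hcard
  have : Finite (𝓞 k ⧸ v.asIdeal) := Nat.finite_of_card_ne_zero (by omega)
  let f : Fin 3 → 𝓞 k ⧸ v.asIdeal := fun n ↦ Ideal.Quotient.mk _ ((n : ℕ) : 𝓞 k)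
  have h2 := two_notMem_of_three_mem hv
  have h1 : (1 : 𝓞 k) ∉ v.asIdeal := fun h ↦ v.isPrime.ne_top ((Ideal.eq_top_iff_one _).2 h)
  have hf : Function.Injective f := by
    intro m n hmn
    have hmem := Ideal.Quotient.eq.1 hmn
    fin_cases m <;> fin_cases n
    all_goals first
      | rfl
      | exfalso
        first
        | (refine h1 ?_; have := hmem; norm_num at this; exact this)
        | (refine h2 ?_; have := hmem; norm_num at this; exact this)
  have hsurj := ((Nat.bijective_iff_injective_and_card f).2 ⟨hf, by simpa using hcard.symm⟩).2
  obtain ⟨n, hn⟩ := hsurj (Ideal.Quotient.mk _ x)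
  exact ⟨n, Ideal.Quotient.eq.1 hn.symm⟩

theorem algebraMap_mem_maximalIdeal_iff {v : HeightOneSpectrum (𝓞 k)} (x : 𝓞 k) :
    algebraMap (𝓞 k) (v.adicCompletionIntegers k) x ∈
      IsLocalRing.maximalIdeal (v.adicCompletionIntegers k) ↔ x ∈ v.asIdeal := by
  rw [IsLocalRing.mem_maximalIdeal, mem_nonunits_iff,
    HeightOneSpectrum.adicCompletionIntegers.isUnit_iff_valued_eq_one,
    ← not_iff_not, not_not, ← HeightOneSpectrum.valuation_eq_one_iff_notMem (K := k),
    ← HeightOneSpectrum.valuedAdicCompletion_eq_valuation]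
  rfl

/-- Every element of the completed ring of integers is congruent to an element of `𝓞 k`. -/
theorem exists_sub_algebraMap_mem_maximalIdeal (v : HeightOneSpectrum (𝓞 k))
    (x : v.adicCompletionIntegers k) :
    ∃ a : 𝓞 k, x - algebraMap (𝓞 k) (v.adicCompletionIntegers k) a ∈
      IsLocalRing.maximalIdeal (v.adicCompletionIntegers k) := by
  have hopen : IsOpen {y : v.adicCompletion k | Valued.v (y - x) < 1} := by
    have := (Valued.isOpen_ball (v.adicCompletion k) 1).preimage
      (continuous_id.sub (continuous_const (y := (x : v.adicCompletion k))))
    simpa [Set.preimage, Valuation.restrict_lt_one_iff] using this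
  obtain ⟨y, hy⟩ := (HeightOneSpectrum.denseRange_algebraMap (K := k) v).exists_mem_open hopen
    ⟨x, by simp⟩
  have hy1 : v.valuation k y ≤ 1 := by
    have h := Valuation.map_add_le (Valued.v (R := v.adicCompletion k)) (le_of_lt hy) x.2
    rw [sub_add_cancel] at h
    rw [← HeightOneSpectrum.valuedAdicCompletion_eq_valuation']
    exact h
  obtain ⟨a, ha⟩ := v.exists_valuation_sub_lt_of_integer hy1 1
  refine ⟨a, ?_⟩
  rw [IsLocalRing.mem_maximalIdeal, mem_nonunits_iff,
    HeightOneSpectrum.adicCompletionIntegers.isUnit_iff_valued_eq_one]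
  refine ne_of_lt ?_
  rw [← HeightOneSpectrum.valuedAdicCompletion_eq_valuation'] at ha
  have ha' : Valued.v (algebraMap k (v.adicCompletion k) (algebraMap (𝓞 k) k a) -
      algebraMap k (v.adicCompletion k) y) < 1 := by
    rw [← map_sub]; exact ha
  have h := Valuation.map_add_lt (Valued.v (R := v.adicCompletion k)) ha' hy
  rw [sub_add_sub_cancel, Valuation.map_sub_swap] at h
  exact h

theorem exists_natCast_sub_mem_maximalIdeal {v : HeightOneSpectrum (𝓞 k)}
    (hv : (3 : 𝓞 k) ∈ v.asIdeal) (hcard : Ideal.absNorm v.asIdeal = 3)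
    (x : v.adicCompletionIntegers k) :
    ∃ n : Fin 3, x - (n : ℕ) ∈ IsLocalRing.maximalIdeal (v.adicCompletionIntegers k) := by
  obtain ⟨a, ha⟩ := exists_sub_algebraMap_mem_maximalIdeal v x
  obtain ⟨n, hn⟩ := exists_natCast_sub_mem hv hcard a
  refine ⟨n, ?_⟩
  have := add_mem ha ((algebraMap_mem_maximalIdeal_iff _).2 hn)
  rwa [map_sub, map_natCast, sub_add_sub_cancel] at this

end Residue

section Local

variable {k : Type u} {ℓ : Type v} {D : Type w} [Field k] [NumberField k] [Field ℓ] [NumberField ℓ]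
  [Algebra k ℓ] [DivisionRing D] [Algebra k D] [Algebra ℓ D] [IsScalarTower k ℓ D]

omit [NumberField k] [NumberField ℓ] in
/-- In `k(i)` with `k = ℚ(√7)`, the period is `(-1 + √-7) / 2` for one of the square roots of `-7`. -/
theorem exists_sqrt_of_period {s : k} {i η : ℓ} (hs : s ^ 2 = 7) (hi : i ^ 2 = -1)
    (hη : η ^ 2 + η + 2 = 0) : ∃ t : k, t ^ 2 = 7 ∧ 2 * η = -1 + algebraMap k ℓ t * i := by
  have hs' : algebraMap k ℓ s ^ 2 = 7 := by rw [← map_pow, hs, map_ofNat]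
  have h : (2 * η + 1 - algebraMap k ℓ s * i) * (2 * η + 1 + algebraMap k ℓ s * i) = 0 := by
    linear_combination 4 * hη - i ^ 2 * hs' - 7 * hi
  rcases mul_eq_zero.1 h with h | h
  · exact ⟨s, hs, by linear_combination h⟩
  · exact ⟨-s, by rw [neg_sq, hs], by rw [map_neg]; linear_combination h⟩

/-- The embedding of `D` in `k_v ⊗ D`. -/
noncomputable abbrev toLocalAlg (D : Type w) [DivisionRing D] [Algebra k D]
    (v : HeightOneSpectrum (𝓞 k)) : D →ₐ[k] LocalAlg D v :=
  Algebra.TensorProduct.includeRight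

omit [NumberField ℓ] in
theorem isSexticDatum_toLocalAlg {v : HeightOneSpectrum (𝓞 k)} (hv : (3 : 𝓞 k) ∈ v.asIdeal)
    (hcard : Ideal.absNorm v.asIdeal = 3) {ϖ : v.adicCompletionIntegers k} (hϖ : Irreducible ϖ)
    {s : k} {i η : ℓ} (hs : s ^ 2 = 7) (hi : i ^ 2 = -1) (hη : η ^ 2 + η + 2 = 0) {g : D}
    (hg : g + g ^ 2 + g ^ 4 = algebraMap ℓ D η) (hsum : ∑ j ∈ Finset.range 7, g ^ j = 0) :
    IsSexticDatum ϖ (toLocalAlg D v (algebraMap ℓ D i)) (toLocalAlg D v g) where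
  irreducible := hϖ
  dvd_three := by
    have h := (algebraMap_mem_maximalIdeal_iff (v := v) 3).2 hv
    rwa [map_ofNat, hϖ.maximalIdeal_eq, Ideal.mem_span_singleton] at h
  residue x := by
    obtain ⟨n, hn⟩ := exists_natCast_sub_mem_maximalIdeal hv hcard x
    rw [hϖ.maximalIdeal_eq, Ideal.mem_span_singleton] at hn
    exact ⟨n, hn⟩
  central a := by
    induction a using TensorProduct.induction_on with
    | zero => simp
    | add x y hx hy => rw [mul_add, add_mul, hx, hy]
    | tmul c x =>
      rw [Algebra.TensorProduct.includeRight_apply, Algebra.TensorProduct.tmul_mul_tmul,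
        Algebra.TensorProduct.tmul_mul_tmul, one_mul, mul_one, Algebra.commutes]
  sq := by rw [← map_mul, ← map_mul, ← pow_two, hi, map_neg, map_one, map_neg, map_one]
  sum := by simpa using congrArg (toLocalAlg D v) hsum
  period := by
    obtain ⟨t, ht, htη⟩ := exists_sqrt_of_period hs hi hη
    obtain ⟨b, hb⟩ := (isUnit_natCast_adicCompletionIntegers (v := v) (n := 2)
      (by exact_mod_cast two_notMem_of_three_mem hv)).exists_left_inv
    have htint : IsIntegral ℤ t := IsIntegral.of_pow two_pos (by
      rw [ht, ← map_ofNat (algebraMap ℤ k) 7]; exact isIntegral_algebraMap)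
    let t' : 𝓞 k := ⟨t, htint⟩
    refine ⟨-b, b * algebraMap (𝓞 k) _ t', ?_⟩
    have h2 : algebraMap _ (LocalAlg D v) b * 2 = 1 := by
      rw [← map_ofNat (algebraMap (v.adicCompletionIntegers k) (LocalAlg D v)) 2, ← map_mul]
      rw [show b * OfNat.ofNat 2 = 1 from by exact_mod_cast hb, map_one]
    have ht' : algebraMap _ (LocalAlg D v) (algebraMap (𝓞 k) (v.adicCompletionIntegers k) t') =
        toLocalAlg D v (algebraMap ℓ D (algebraMap k ℓ t)) := by
      rw [← IsScalarTower.algebraMap_apply k ℓ D, AlgHom.commutes,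
        IsScalarTower.algebraMap_apply k (v.adicCompletion k) (LocalAlg D v),
        IsScalarTower.algebraMap_apply (v.adicCompletionIntegers k) (v.adicCompletion k)
          (LocalAlg D v)]
      rfl
    have hmain : 2 * toLocalAlg D v (algebraMap ℓ D η) = -1 +
        toLocalAlg D v (algebraMap ℓ D (algebraMap k ℓ t)) * toLocalAlg D v (algebraMap ℓ D i) := by
      rw [← map_mul, ← map_mul, ← map_ofNat (toLocalAlg D v) 2, ← map_mul,
        ← map_ofNat (algebraMap ℓ D) 2, ← map_mul, htη, map_add, map_add, map_neg, map_one, map_neg,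
        map_one]
    calc toLocalAlg D v g + toLocalAlg D v g ^ 2 + toLocalAlg D v g ^ 4
        = algebraMap _ (LocalAlg D v) b * 2 * toLocalAlg D v (algebraMap ℓ D η) := by
          rw [h2, one_mul, ← hg, map_add, map_add, map_pow, map_pow]
      _ = _ := by
          rw [mul_assoc, hmain, map_mul, ht', map_neg, mul_add, mul_neg_one, mul_assoc]

end Local

/-! ### Torsion and non-hyperspecial parahoric subgroups -/

section Parahoric

variable {k : Type u} {ℓ : Type v} {D : Type w} [Field k] [NumberField k] [Field ℓ] [NumberField ℓ]
  [Algebra k ℓ] [DivisionRing D] [Algebra k D] [Algebra ℓ D] [IsScalarTower k ℓ D]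

theorem toLocalAlg_mem_adjoin (v : HeightOneSpectrum (𝓞 k)) {x y c : D}
    (hc : c ∈ Algebra.adjoin k {x, y}) :
    toLocalAlg D v c ∈ Algebra.adjoin (v.adicCompletion k) {toLocalAlg D v x, toLocalAlg D v y} := by
  induction hc using Algebra.adjoin_induction with
  | mem z hz =>
    rcases hz with rfl | rfl
    · exact Algebra.subset_adjoin (Or.inl rfl)
    · exact Algebra.subset_adjoin (Or.inr rfl)
  | algebraMap a =>
    rw [AlgHom.commutes, IsScalarTower.algebraMap_apply k (v.adicCompletion k) (LocalAlg D v)]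
    exact Subalgebra.algebraMap_mem _ _
  | add x y _ _ hx hy => rw [map_add]; exact add_mem hx hy
  | mul x y _ _ hx hy => rw [map_mul]; exact mul_mem hx hy

/-- The decomposition of `D` over the subfield `k(i, g)` induces one of `k_v ⊗ D`. -/
theorem exists_decomposition_localAlg (v : HeightOneSpectrum (𝓞 k)) {x y u : D}
    (h : ∀ a : D, ∃ f₀ ∈ Algebra.adjoin k {x, y}, ∃ f₁ ∈ Algebra.adjoin k {x, y},
      ∃ f₂ ∈ Algebra.adjoin k {x, y}, a = f₀ + f₁ * u + f₂ * u ^ 2) (a : LocalAlg D v) :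
    ∃ f₀ ∈ Algebra.adjoin (v.adicCompletion k) {toLocalAlg D v x, toLocalAlg D v y},
      ∃ f₁ ∈ Algebra.adjoin (v.adicCompletion k) {toLocalAlg D v x, toLocalAlg D v y},
      ∃ f₂ ∈ Algebra.adjoin (v.adicCompletion k) {toLocalAlg D v x, toLocalAlg D v y},
      a = f₀ + f₁ * toLocalAlg D v u + f₂ * toLocalAlg D v u ^ 2 := by
  induction a using TensorProduct.induction_on with
  | zero => exact ⟨0, zero_mem _, 0, zero_mem _, 0, zero_mem _, by simp⟩
  | add a b ha hb =>
    obtain ⟨f₀, h₀, f₁, h₁, f₂, h₂, rfl⟩ := ha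
    obtain ⟨f₀', h₀', f₁', h₁', f₂', h₂', rfl⟩ := hb
    refine ⟨_, add_mem h₀ h₀', _, add_mem h₁ h₁', _, add_mem h₂ h₂', ?_⟩
    rw [add_mul, add_mul]
    abel
  | tmul c a =>
    obtain ⟨f₀, h₀, f₁, h₁, f₂, h₂, rfl⟩ := h a
    refine ⟨_, Subalgebra.smul_mem _ (toLocalAlg_mem_adjoin v h₀) c,
      _, Subalgebra.smul_mem _ (toLocalAlg_mem_adjoin v h₁) c,
      _, Subalgebra.smul_mem _ (toLocalAlg_mem_adjoin v h₂) c, ?_⟩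
    rw [smul_mul_assoc, smul_mul_assoc, ← smul_add, ← smul_add, ← map_pow, ← map_mul, ← map_mul,
      ← map_add, ← map_add, Algebra.TensorProduct.includeRight_apply, TensorProduct.smul_tmul',
      smul_eq_mul, mul_one]

theorem localInv_toLocalAlg (σ : AlgInvolution k D) (v : HeightOneSpectrum (𝓞 k)) (x : D) :
    (localInv σ v).toLin (toLocalAlg D v x) = toLocalAlg D v (σ.toLin x) :=
  LinearMap.baseChange_tmul _ _ _

/-- At a place of `k` over `3`, a maximal `σ`-stable order containing an element of order seven
is a maximal order. -/
theorem isMaximalOrder_of_orderOf_eq_seven (h : IsC20 k ℓ) {σ : AlgInvolution k D}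
    {v₀ : k →+* ℝ} {𝔳 : HeightOneSpectrum (𝓞 k)} (hG : IsGroupDatum ℓ σ v₀ 𝔳)
    {v v' : HeightOneSpectrum (𝓞 k)} (hne : v ≠ v') (hv : (3 : 𝓞 k) ∈ v.asIdeal)
    (hv' : (3 : 𝓞 k) ∈ v'.asIdeal) {g : Dˣ} (hg : g ∈ specialUnitary σ) (h7 : orderOf g = 7)
    {R : Subalgebra (v.adicCompletionIntegers k) (LocalAlg D v)} (hR : IsMaximalStableOrder σ v R)
    (hgR : toLocal D v g ∈ unitsOf R) : IsMaximalOrder (v.adicCompletion k) R := by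
  have := hG.central
  have h9 := hG.finrank_eq
  obtain ⟨s, i, hs, hi4, hk, hℓ⟩ := id h
  have hi := sq_eq_neg_one_of_isPrimitiveRoot_four hi4
  have hcard := absNorm_eq_three
    (finrank_le_two_of_adjoin_eq_top (d := 7) (by rw [hs, map_ofNat]) hk) hne hv hv'
  have hc : (g : D) ∉ (algebraMap ℓ D).range := fun hc ↦ by
    rw [eq_one_of_mem_range_of_mem_specialUnitary h.not_isSquare_neg_three h9 hg hc,
      orderOf_one] at h7
    omega
  obtain ⟨⟨η, hη, hgη⟩, hsum, h3⟩ := exists_period_of_orderOf_eq_seven h h9 h7 hc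
  obtain ⟨u, hu⟩ := exists_conj_eq_sq hc hη hgη hsum
  obtain ⟨ϖ, hϖ⟩ := IsDiscreteValuationRing.exists_irreducible (v.adicCompletionIntegers k)
  have hmem {c : D} (hc : c * g = g * c) : c ∈ Algebra.adjoin k {algebraMap ℓ D i, (g : D)} :=
    mem_adjoin_pair_of_mem_adjoin hi hℓ (mem_adjoin_of_commute h9 hsum h3 hu hc)
  have hdatum : IsCyclicDatum (v.adicCompletion k) ϖ (toLocalAlg D v (algebraMap ℓ D i))
      (toLocalAlg D v g) 2 (toLocal D v u) :=
    { sextic := isSexticDatum_toLocalAlg hv hcard hϖ hs hi hη hgη hsum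
      exponent := Or.inl rfl
      conj := by
        have := congrArg (toLocalAlg D v) hu
        rwa [map_mul, map_mul, map_pow] at this
      decomp := exists_decomposition_localAlg v fun a ↦ by
        obtain ⟨c₀, c₁, c₂, h₀, h₁, h₂, ha⟩ := exists_centralizer_decomposition hη hgη hsum hu a
        exact ⟨c₀, hmem h₀, c₁, hmem h₁, c₂, hmem h₂, ha⟩ }
  have hσg : σ.toLin (g : D) = (g : D) ^ 6 := by
    have h1 : (g : D) * σ.toLin g = 1 := hg.1
    have h2 : (g : D) * (g : D) ^ 6 = 1 := by
      rw [← pow_succ', ← Units.val_pow_eq_pow_val, show 6 + 1 = orderOf g from h7.symm,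
        pow_orderOf_eq_one, Units.val_one]
    exact mul_left_cancel₀ g.ne_zero (h1.trans h2.symm)
  refine hdatum.isMaximalOrder (localInv σ v) ?_ ?_ hR ?_
  · rw [localInv_toLocalAlg, map_eq_neg_of_second_kind hi hℓ hG.second_kind, map_neg]
  · rw [localInv_toLocalAlg, hσg, map_pow]
  · obtain ⟨x, hx⟩ := hgR
    have : ((x : R) : LocalAlg D v) = toLocalAlg D v g := congrArg Units.val hx
    exact this ▸ x.1.2

/-- A non-hyperspecial maximal parahoric subgroup at a place over `3` contains no torsion
of `G(k)`. -/
theorem isTorsionFreeSubgroup_principalSubgroupAt (h : IsC20 k ℓ) {σ : AlgInvolution k D}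
    {v₀ : k →+* ℝ} {𝔳 : HeightOneSpectrum (𝓞 k)} (hG : IsGroupDatum ℓ σ v₀ 𝔳)
    (h2 : (2 : 𝓞 k) ∈ 𝔳.asIdeal) (P : ∀ v : HeightOneSpectrum (𝓞 k), Subgroup (LocalAlg D v)ˣ)
    {v v' : HeightOneSpectrum (𝓞 k)} (hne : v ≠ v') (hv : (3 : 𝓞 k) ∈ v.asIdeal)
    (hv' : (3 : 𝓞 k) ∈ v'.asIdeal) {Q : Subgroup (LocalAlg D v)ˣ} (hQ : IsMaximalParahoric σ v Q)
    (hQ' : ¬ IsHyperspecial ℓ σ v Q) : IsTorsionFreeSubgroup (principalSubgroupAt σ P v Q) := by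
  rintro g ⟨⟨hg, hgQ⟩, -⟩ hfin
  by_contra hg1
  have := hG.central
  have h7 := orderOf_eq_seven_of_isC20 h hG.finrank_eq hg hfin hg1
  obtain ⟨R, hR, rfl⟩ := hQ
  refine hQ' ⟨fun w hw ↦ (hG.split_iff w).2 fun hw' ↦ ?_, R,
    isMaximalOrder_of_orderOf_eq_seven h hG hne hv hv' hg h7 hR hgQ.2, hR.prop.2, rfl⟩
  refine two_notMem_of_three_mem hv ?_
  rwa [hw.over, ← hw'.over]

end Parahoric

theorem mainTheorem9 {k : Type u} {ℓ : Type v} {D : Type w}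
    [Field k] [NumberField k] [Field ℓ] [NumberField ℓ] [Algebra k ℓ]
    [DivisionRing D] [Algebra k D] [Algebra ℓ D] [IsScalarTower k ℓ D]
    (σ : AlgInvolution k D) (v₀ : k →+* ℝ) (𝔳 : HeightOneSpectrum (𝓞 k))
    (hG : IsGroupDatum ℓ σ v₀ 𝔳) :
    (IsC20 k ℓ → (2 : 𝓞 k) ∈ 𝔳.asIdeal →
      (∀ g ∈ specialUnitary σ, IsOfFinOrder g → g ≠ 1 → orderOf g = 7) ∧
      ∀ P : ∀ v : HeightOneSpectrum (𝓞 k), Subgroup (LocalAlg D v)ˣ,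
        IsCoherent σ P →
        (∀ v, IsMaximalParahoric σ v (P v)) →
        (∀ v, v ≠ 𝔳 → IsHyperspecial ℓ σ v (P v)) →
        IsTorsionFreeSubgroup
          (principalSubgroup σ P ⊓ (localGroupPlus σ 𝔳).comap (toLocal D 𝔳)) ∧
        ∀ (v' v'' : HeightOneSpectrum (𝓞 k)), v' ≠ v'' →
          (3 : 𝓞 k) ∈ v'.asIdeal → (3 : 𝓞 k) ∈ v''.asIdeal →
        ∀ (P' : Subgroup (LocalAlg D v')ˣ) (P'' : Subgroup (LocalAlg D v'')ˣ),
          IsMaximalParahoric σ v' P' → ¬ IsHyperspecial ℓ σ v' P' →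
          IsMaximalParahoric σ v'' P'' → ¬ IsHyperspecial ℓ σ v'' P'' →
          IsTorsionFreeSubgroup (principalSubgroupAt σ P v' P') ∧
          IsTorsionFreeSubgroup (principalSubgroupAt σ P v'' P'')) ∧
    ((IsC26 k ℓ ∧ (2 : 𝓞 k) ∈ 𝔳.asIdeal) ∨ (IsC35 k ℓ ∧ (5 : 𝓞 k) ∈ 𝔳.asIdeal) →
      IsTorsionFreeSubgroup (specialUnitary σ)) := by
  have := hG.central
  have h9 := hG.finrank_eq
  refine ⟨fun h h2 ↦ ?_, ?_⟩
  · have h7 : ∀ g ∈ specialUnitary σ, IsOfFinOrder g → g ≠ 1 → orderOf g = 7 :=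
      fun g hg hfin h1 ↦ orderOf_eq_seven_of_isC20 h h9 hg hfin h1
    refine ⟨h7, fun P _ hP _ ↦ ⟨isTorsionFreeSubgroup_congruence h2 h7 P (hP 𝔳), ?_⟩⟩
    intro v' v'' hne hv' hv'' P' P'' hP' hP'' hQ' hQ''
    exact ⟨isTorsionFreeSubgroup_principalSubgroupAt h hG h2 P hne hv' hv'' hP' hP'',
      isTorsionFreeSubgroup_principalSubgroupAt h hG h2 P hne.symm hv'' hv' hQ' hQ''⟩
  · rintro (⟨h, -⟩ | ⟨h, -⟩)
    · exact isTorsionFreeSubgroup_specialUnitary_of_isC26 h h9 σ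
    · exact isTorsionFreeSubgroup_specialUnitary_of_isC35 h h9 σ
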